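/- Let $K$ be a field, let $\delta\in K$ with $\delta\neq 2$ and $\delta\neq -2$, and let $n,m,m'$ be natural numbers. **Notation.** An $(n,m)$-diagram consists of $n$ source sites in a left-hand column and $m$ target sites in a right-hand column, paired by $(n+m)/2$ non-crossing lines in the strip between the columns (considered up to isotopy). The Temperley–Lieb category over $(K,\delta)$ has the natural numbers as objects; $\operatorname{Hom}(n,m)$ is the $K$-vector space with basis the $(n,m)$-diagrams, and composition is the bilinear extension of juxtaposition of diagrams, each closed loop being replaced by a factor $\delta$. Let $TL_n=\operatorname{End}(n)$. The cell module $S(n,m)$ is the quotient of the left $TL_n$-module $\operatorname{Hom}(n,m)$ by the submodule generated by all morphisms that factor through some $i<m$. Let $\iota$ be the duality that reflects diagrams so as to exchange the two columns. The standard bilinear form on $S(n,m)$ is induced by letting $\langle x,y\rangle$ be the coefficient of the identity diagram of $m$ in the composite $m\to n\to m$ of $\iota(x)$ followed by $y$. Let $R(n,m)$ be its kernel and $D(n,m)=S(n,m)/R(n,m)$. The quantum numbers $[k]\in K$ are given by $[0]=0$, $[1]=1$ and $\delta[k]=[k+1]+[k-1]$. Let $\ell$ be the least positive integer with $[\ell]=0$,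 or $\ell=\infty$ if there is none; the only multiple of $\infty$ is $0$. Let $G$ be the group of permutations of $\mathbb Z$ generated by the reflections $x\mapsto 2c-x$ about the integers $c$ such that $c+1$ is a multiple of $\ell$ (for finite $\ell$ this is the infinite dihedral group generated by the reflections about $-1$ and $\ell-1$). **Theorem.** If $D(n,m)$ is a composition factor of the $TL_n$-module $S(n,m')$, then $m\ge m'$, and $m$ and $m'$ lie in the same orbit of $G$ on $\mathbb Z$. -/

import Mathlib

namespace TemperleyLieb

section Gluing

variable {A B C D : Type}

/-- Glue an equivalence relation on `A ⊔ B` to one on `B ⊔ C` along `B`. -/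
def glue (r : Setoid (A ⊕ B)) (s : Setoid (B ⊕ C)) : Setoid (A ⊕ B ⊕ C) :=
  r.map (Sum.map id Sum.inl) ⊔ s.map Sum.inr

/-- The outer points of the glued picture. -/
def outer : A ⊕ C → A ⊕ B ⊕ C := Sum.map id Sum.inr

/-- The number of classes of `Z` that do not meet the image of `h`. -/
noncomputable def floating {X O : Type} (Z : Setoid X) (h : O → X) : ℕ :=
  Nat.card {c : Quotient Z // ∀ o, Quotient.mk Z (h o) ≠ c}

theorem map_le_iff {X Y : Type} {r : Setoid X} {f : X → Y} {t : Setoid Y} :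
    r.map f ≤ t ↔ r ≤ t.comap f := by
  constructor
  · intro h x y hxy
    exact h (Relation.EqvGen.rel _ _ ⟨x, y, hxy, rfl, rfl⟩)
  · intro h
    refine Setoid.eqvGen_le ?_
    rintro _ _ ⟨x, y, hxy, rfl, rfl⟩
    exact h hxy

theorem map_sup {X Y : Type} (r s : Setoid X) (f : X → Y) :
    (r ⊔ s).map f = r.map f ⊔ s.map f :=
  GaloisConnection.l_sup (l := fun r : Setoid X => r.map f) (u := fun t => t.comap f)
    fun _ _ => map_le_iff

theorem map_map {X Y Z : Type} (r : Setoid X) (f : X → Y) (g : Y → Z) :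
    (r.map f).map g = r.map (g ∘ f) := by
  apply le_antisymm
  · rw [map_le_iff, map_le_iff]
    exact (map_le_iff (f := g ∘ f)).1 le_rfl
  · rw [map_le_iff]
    intro x y h
    exact map_le_iff.1 le_rfl (map_le_iff.1 le_rfl h)

theorem rel_map {X Y : Type} {r : Setoid X} (f : X → Y) {x y : X} (h : r x y) :
    r.map f (f x) (f y) := map_le_iff.1 le_rfl h

theorem floating_add {X O : Type} [Finite X] (Z : Setoid X) (h : O → X) :
    floating Z h + Nat.card (Quotient (Z.comap h)) = Nat.card (Quotient Z) := by
  classical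
  have e := Nat.card_congr (Setoid.comapQuotientEquiv h Z)
  have e2 := Nat.card_congr
    (Equiv.sumCompl (fun c : Quotient Z => ∃ o, Quotient.mk Z (h o) = c))
  rw [Nat.card_sum] at e2
  rw [e, ← e2, add_comm, floating]
  congr 1
  exact Nat.card_congr (Equiv.subtypeEquivRight fun c => by simp)

section Pushout

variable {X Y X₀ O : Type} {f : Y → X} {g : X₀ → X} {h : O → X₀} {k : O → Y}

open Classical in
/-- Auxiliary invariant of the classes of a relation glued from `Z` and `T`. -/
noncomputable def glueInv (f : Y → X) (g : X₀ → X) (h : O → X₀) (k : O → Y)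
    (Z : Setoid X₀) (T : Setoid Y) (x : X) :
    Option (Quotient ((Z.comap h).map k ⊔ T) ⊕ Quotient Z) :=
  if hy : ∃ y, f y = x then some (Sum.inl (Quotient.mk _ hy.choose))
  else if hz : ∃ z, g z = x then
    if ho : ∃ o, Z hz.choose (h o) then some (Sum.inl (Quotient.mk _ (k ho.choose)))
    else some (Sum.inr (Quotient.mk _ hz.choose))
  else none

theorem glueInv_f (hf : Function.Injective f)
    (Z : Setoid X₀) (T : Setoid Y) (y : Y) :
    glueInv f g h k Z T (f y) = some (Sum.inl (Quotient.mk _ y)) := by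
  have hy : ∃ y', f y' = f y := ⟨y, rfl⟩
  rw [glueInv, dif_pos hy, hf hy.choose_spec]

theorem glueInv_g_pos (hf : Function.Injective f)
    (pull : ∀ y z, f y = g z → ∃ o, y = k o ∧ z = h o)
    (Z : Setoid X₀) (T : Setoid Y) (hg : Function.Injective g) (z : X₀) (o : O) (ho : Z z (h o)) :
    glueInv f g h k Z T (g z) = some (Sum.inl (Quotient.mk _ (k o))) := by
  by_cases hy : ∃ y, f y = g z
  · obtain ⟨y, hy⟩ := hy
    rw [← hy, glueInv_f hf]
    obtain ⟨o', rfl, rfl⟩ := pull y z hy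
    congr 2
    exact Quotient.sound (Setoid.le_def.1 le_sup_left (rel_map k ho))
  · have hz : ∃ z', g z' = g z := ⟨z, rfl⟩
    have e := hg hz.choose_spec
    have ho' : ∃ o, Z hz.choose (h o) := ⟨o, by rw [e]; exact ho⟩
    rw [glueInv, dif_neg hy, dif_pos hz, dif_pos ho']
    congr 2
    refine Quotient.sound (Setoid.le_def.1 le_sup_left (rel_map k ?_))
    have := ho'.choose_spec
    exact Z.trans (Z.symm this) (by rw [e]; exact ho)

theorem glueInv_g_neg (pull : ∀ y z, f y = g z → ∃ o, y = k o ∧ z = h o)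
    (Z : Setoid X₀) (T : Setoid Y) (hg : Function.Injective g) (z : X₀) (ho : ¬ ∃ o, Z z (h o)) :
    glueInv f g h k Z T (g z) = some (Sum.inr (Quotient.mk _ z)) := by
  have hy : ¬ ∃ y, f y = g z := by
    rintro ⟨y, hy⟩
    obtain ⟨o', rfl, rfl⟩ := pull y z hy
    exact ho ⟨o', Z.refl _⟩
  have hz : ∃ z', g z' = g z := ⟨z, rfl⟩
  have e := hg hz.choose_spec
  rw [glueInv, dif_neg hy, dif_pos hz, dif_neg (by rw [e]; exact ho), e]

theorem glue_le_ker (hf : Function.Injective f)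
    (pull : ∀ y z, f y = g z → ∃ o, y = k o ∧ z = h o)
    (Z : Setoid X₀) (T : Setoid Y) (hg : Function.Injective g) :
    Z.map g ⊔ T.map f ≤ Setoid.ker (glueInv f g h k Z T) := by
  rw [sup_le_iff, map_le_iff, map_le_iff]
  constructor
  · intro z z' hzz
    change glueInv f g h k Z T (g z) = glueInv f g h k Z T (g z')
    by_cases ho : ∃ o, Z z (h o)
    · obtain ⟨o, ho⟩ := ho
      rw [glueInv_g_pos hf pull Z T hg z o ho,
        glueInv_g_pos hf pull Z T hg z' o (Z.trans (Z.symm hzz) ho)]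
    · have ho' : ¬ ∃ o, Z z' (h o) := fun ⟨o, h'⟩ => ho ⟨o, Z.trans hzz h'⟩
      rw [glueInv_g_neg pull Z T hg z ho, glueInv_g_neg pull Z T hg z' ho']
      congr 2
      exact Quotient.sound hzz
  · intro y y' hyy
    change glueInv f g h k Z T (f y) = glueInv f g h k Z T (f y')
    rw [glueInv_f hf, glueInv_f hf]
    congr 2
    exact Quotient.sound (Setoid.le_def.1 le_sup_right hyy)

theorem comap_pushout (hf : Function.Injective f)
    (comm : ∀ o, f (k o) = g (h o))
    (pull : ∀ y z, f y = g z → ∃ o, y = k o ∧ z = h o)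
    (Z : Setoid X₀) (T : Setoid Y) (hg : Function.Injective g) :
    (Z.map g ⊔ T.map f).comap f = (Z.comap h).map k ⊔ T := by
  apply le_antisymm
  · intro y y' hyy
    have := glue_le_ker hf pull Z T hg hyy
    change glueInv f g h k Z T (f y) = glueInv f g h k Z T (f y') at this
    rw [glueInv_f hf, glueInv_f hf] at this
    exact Quotient.exact (Sum.inl_injective (Option.some_injective _ this))
  · rw [sup_le_iff, map_le_iff]
    constructor
    · intro o o' hoo
      change (Z.map g ⊔ T.map f) (f (k o)) (f (k o'))
      rw [comm, comm]
      exact Setoid.le_def.1 le_sup_left (rel_map g hoo)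
    · intro y y' hyy
      exact Setoid.le_def.1 le_sup_right (rel_map f hyy)

theorem floating_pushout (hf : Function.Injective f)
    (comm : ∀ o, f (k o) = g (h o))
    (cover : ∀ x, (∃ y, f y = x) ∨ ∃ z, g z = x)
    (pull : ∀ y z, f y = g z → ∃ o, y = k o ∧ z = h o)
    (Z : Setoid X₀) (T : Setoid Y) (hg : Function.Injective g) :
    floating (Z.map g ⊔ T.map f) f = floating Z h := by
  symm
  let W := Z.map g ⊔ T.map f
  have hZW : ∀ {z z'}, Z z z' → W (g z) (g z') := fun hzz =>
    Setoid.le_def.1 le_sup_left (rel_map g hzz)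
  let F : Quotient Z → Quotient W := Quotient.map g fun _ _ hzz => hZW hzz
  have hF : ∀ c : Quotient Z, (∀ o, Quotient.mk Z (h o) ≠ c) →
      ∀ y, Quotient.mk W (f y) ≠ F c := by
    intro c
    induction c using Quotient.inductionOn with
    | _ z =>
      intro hc y hy
      have := glue_le_ker hf pull Z T hg (Quotient.exact hy)
      change glueInv f g h k Z T (f y) = glueInv f g h k Z T (g z) at this
      rw [glueInv_f hf, glueInv_g_neg pull Z T hg z
        (fun ⟨o, ho⟩ => hc o (Quotient.sound (Z.symm ho)))] at this
      cases this
  refine Nat.card_congr (Equiv.ofBijective (fun c => ⟨F c.1, hF c.1 c.2⟩) ⟨?_, ?_⟩)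
  · rintro ⟨c, hc⟩ ⟨c', hc'⟩ heq
    have heq : F c = F c' := congrArg Subtype.val heq
    apply Subtype.ext
    change c = c'
    induction c using Quotient.inductionOn with
    | _ z =>
    induction c' using Quotient.inductionOn with
    | _ z' =>
      have := glue_le_ker hf pull Z T hg (Quotient.exact heq)
      change glueInv f g h k Z T (g z) = glueInv f g h k Z T (g z') at this
      rw [glueInv_g_neg pull Z T hg z
        (fun ⟨o, ho⟩ => hc o (Quotient.sound (Z.symm ho))), glueInv_g_neg pull Z T hg z'
        (fun ⟨o, ho⟩ => hc' o (Quotient.sound (Z.symm ho)))] at this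
      exact Sum.inr_injective (Option.some_injective _ this)
  · rintro ⟨c, hc⟩
    induction c using Quotient.inductionOn with
    | _ x =>
      rcases cover x with ⟨y, rfl⟩ | ⟨z, rfl⟩
      · exact absurd rfl (hc y)
      · refine ⟨⟨Quotient.mk _ z, fun o ho => hc (k o) ?_⟩, rfl⟩
        rw [comm]
        exact Quotient.sound (hZW (Quotient.exact ho))

end Pushout

/-- The relation induced on the outer points of a glued picture. -/
def joinRel (r : Setoid (A ⊕ B)) (s : Setoid (B ⊕ C)) : Setoid (A ⊕ C) :=
  (glue r s).comap outer

/-- The number of closed components of a glued picture. -/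
noncomputable def joinLoops (r : Setoid (A ⊕ B)) (s : Setoid (B ⊕ C)) : ℕ :=
  floating (glue r s) outer

section Assoc

variable (r : Setoid (A ⊕ B)) (s : Setoid (B ⊕ C)) (t : Setoid (C ⊕ D))

def glue₃ : Setoid (A ⊕ B ⊕ C ⊕ D) :=
  r.map (Sum.map id Sum.inl) ⊔ s.map (Sum.inr ∘ Sum.map id Sum.inl) ⊔ t.map (Sum.inr ∘ Sum.inr)

theorem glue₃_left : glue₃ r s t =
    (glue r s).map (Sum.map id (Sum.map id Sum.inl)) ⊔
      (t.map (Sum.inr : C ⊕ D → A ⊕ C ⊕ D)).map (Sum.map id Sum.inr) := by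
  rw [glue, map_sup, map_map, map_map, map_map]
  have e1 : (Sum.map id (Sum.map id Sum.inl) ∘ Sum.map id Sum.inl :
      A ⊕ B → A ⊕ B ⊕ C ⊕ D) = Sum.map id Sum.inl := by
    funext x; rcases x with a | b <;> rfl
  have e2 : (Sum.map id (Sum.map id Sum.inl) ∘ Sum.inr :
      B ⊕ C → A ⊕ B ⊕ C ⊕ D) = Sum.inr ∘ Sum.map id Sum.inl := by
    funext x; rcases x with a | b <;> rfl
  have e3 : (Sum.map id Sum.inr ∘ Sum.inr :
      C ⊕ D → A ⊕ B ⊕ C ⊕ D) = Sum.inr ∘ Sum.inr := by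
    funext x; rcases x with a | b <;> rfl
  rw [e1, e2, e3]
  rfl

theorem glue₃_right : glue₃ r s t =
    (glue s t).map Sum.inr ⊔
      (r.map (Sum.map id Sum.inl : A ⊕ B → A ⊕ B ⊕ D)).map (Sum.map id (Sum.map id Sum.inr)) := by
  rw [glue, map_sup, map_map, map_map, map_map]
  have e3 : (Sum.map id (Sum.map id Sum.inr) ∘ Sum.map id Sum.inl :
      A ⊕ B → A ⊕ B ⊕ C ⊕ D) = Sum.map id Sum.inl := by
    funext x; rcases x with a | b <;> rfl
  rw [e3, sup_comm, ← sup_assoc]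
  rfl

theorem left_pushout :
    (glue₃ r s t).comap (Sum.map id Sum.inr) = glue (joinRel r s) t ∧
    floating (glue₃ r s t) (Sum.map id Sum.inr : A ⊕ C ⊕ D → A ⊕ B ⊕ C ⊕ D) =
      joinLoops r s := by
  have hf : Function.Injective (Sum.map id Sum.inr : A ⊕ C ⊕ D → A ⊕ B ⊕ C ⊕ D) :=
    Function.Injective.sumMap Function.injective_id Sum.inr_injective
  have hg : Function.Injective (Sum.map id (Sum.map id Sum.inl) : A ⊕ B ⊕ C → A ⊕ B ⊕ C ⊕ D) :=
    Function.Injective.sumMap Function.injective_id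
      (Function.Injective.sumMap Function.injective_id Sum.inl_injective)
  have comm : ∀ o : A ⊕ C, (Sum.map id Sum.inr : A ⊕ C ⊕ D → A ⊕ B ⊕ C ⊕ D)
      (Sum.map id Sum.inl o) = Sum.map id (Sum.map id Sum.inl) (outer (B := B) o) := by
    rintro (a | c) <;> rfl
  have pull : ∀ y z, (Sum.map id Sum.inr : A ⊕ C ⊕ D → A ⊕ B ⊕ C ⊕ D) y =
      Sum.map id (Sum.map id Sum.inl) z → ∃ o : A ⊕ C, y = Sum.map id Sum.inl o ∧
        z = outer (B := B) o := by
    rintro (a | c | d) (a' | b' | c') hyz <;> simp at hyz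
    · exact ⟨Sum.inl a, rfl, by rw [hyz]; rfl⟩
    · exact ⟨Sum.inr c, rfl, by rw [hyz]; rfl⟩
  rw [glue₃_left]
  constructor
  · rw [comap_pushout hf comm pull _ _ hg]
    rfl
  · refine floating_pushout hf comm ?_ pull _ _ hg
    rintro (a | b | c | d)
    · exact Or.inl ⟨Sum.inl a, rfl⟩
    · exact Or.inr ⟨Sum.inr (Sum.inl b), rfl⟩
    · exact Or.inl ⟨Sum.inr (Sum.inl c), rfl⟩
    · exact Or.inl ⟨Sum.inr (Sum.inr d), rfl⟩

theorem right_pushout :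
    (glue₃ r s t).comap (Sum.map id (Sum.map id Sum.inr)) = glue r (joinRel s t) ∧
    floating (glue₃ r s t) (Sum.map id (Sum.map id Sum.inr) : A ⊕ B ⊕ D → A ⊕ B ⊕ C ⊕ D) =
      joinLoops s t := by
  have hf : Function.Injective (Sum.map id (Sum.map id Sum.inr) : A ⊕ B ⊕ D → A ⊕ B ⊕ C ⊕ D) :=
    Function.Injective.sumMap Function.injective_id
      (Function.Injective.sumMap Function.injective_id Sum.inr_injective)
  have hg : Function.Injective (Sum.inr : B ⊕ C ⊕ D → A ⊕ B ⊕ C ⊕ D) := Sum.inr_injective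
  have comm : ∀ o : B ⊕ D, (Sum.map id (Sum.map id Sum.inr) : A ⊕ B ⊕ D → A ⊕ B ⊕ C ⊕ D)
      (Sum.inr o) = Sum.inr (outer (B := C) o) := by
    rintro (a | c) <;> rfl
  have pull : ∀ y z, (Sum.map id (Sum.map id Sum.inr) : A ⊕ B ⊕ D → A ⊕ B ⊕ C ⊕ D) y =
      Sum.inr z → ∃ o : B ⊕ D, y = Sum.inr o ∧ z = outer (B := C) o := by
    rintro (a | c | d) (a' | b' | c') hyz <;> simp at hyz
    · exact ⟨Sum.inl c, rfl, by rw [hyz]; rfl⟩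
    · exact ⟨Sum.inr d, rfl, by rw [hyz]; rfl⟩
  rw [glue₃_right]
  constructor
  · rw [comap_pushout hf comm pull _ _ hg, sup_comm]
    rfl
  · refine floating_pushout hf comm ?_ pull _ _ hg
    rintro (a | b | c | d)
    · exact Or.inl ⟨Sum.inl a, rfl⟩
    · exact Or.inl ⟨Sum.inr (Sum.inl b), rfl⟩
    · exact Or.inr ⟨Sum.inr (Sum.inl c), rfl⟩
    · exact Or.inl ⟨Sum.inr (Sum.inr d), rfl⟩

theorem outer_left : (Sum.map id Sum.inr : A ⊕ C ⊕ D → A ⊕ B ⊕ C ⊕ D) ∘ outer =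
    (Sum.map id (Sum.map id Sum.inr) : A ⊕ B ⊕ D → A ⊕ B ⊕ C ⊕ D) ∘ outer := by
  funext x; rcases x with a | d <;> rfl

theorem joinRel_assoc : joinRel (joinRel r s) t = joinRel r (joinRel s t) := by
  rw [joinRel, ← (left_pushout r s t).1, joinRel, ← (right_pushout r s t).1]
  exact congrArg (fun f => (glue₃ r s t).comap f) outer_left

theorem joinLoops_assoc [Finite A] [Finite B] [Finite C] [Finite D] :
    joinLoops r s + joinLoops (joinRel r s) t = joinLoops s t + joinLoops r (joinRel s t) := by
  have h1 := floating_add (glue₃ r s t) (Sum.map id Sum.inr : A ⊕ C ⊕ D → A ⊕ B ⊕ C ⊕ D)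
  have h2 := floating_add (glue₃ r s t)
    (Sum.map id (Sum.map id Sum.inr) : A ⊕ B ⊕ D → A ⊕ B ⊕ C ⊕ D)
  have h3 := floating_add (glue (joinRel r s) t) outer
  have h4 := floating_add (glue r (joinRel s t)) outer
  rw [(left_pushout r s t).1, (left_pushout r s t).2] at h1
  rw [(right_pushout r s t).1, (right_pushout r s t).2] at h2
  have h5 := congrArg (fun z => Nat.card (Quotient z)) (joinRel_assoc r s t)
  simp only [joinRel] at h5
  unfold joinLoops at *
  simp only [joinRel] at *
  omega

end Assoc

section Flip

def flip3 : A ⊕ B ⊕ C → C ⊕ B ⊕ A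
  | Sum.inl a => Sum.inr (Sum.inr a)
  | Sum.inr (Sum.inl b) => Sum.inr (Sum.inl b)
  | Sum.inr (Sum.inr c) => Sum.inl c

theorem flip3_flip3 (p : A ⊕ B ⊕ C) : flip3 (flip3 p) = p := by
  rcases p with a | b | c <;> rfl

/-- Exchange of the two sides of a relation. -/
def flipRel (r : Setoid (A ⊕ B)) : Setoid (B ⊕ A) := r.comap Sum.swap

theorem glue_le_flip (r : Setoid (A ⊕ B)) (s : Setoid (B ⊕ C)) :
    glue r s ≤ (glue (flipRel s) (flipRel r)).comap flip3 := by
  rw [glue, sup_le_iff, map_le_iff, map_le_iff]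
  constructor
  · intro x y hxy
    have h : (flipRel r) x.swap y.swap := by
      change r x.swap.swap y.swap.swap
      simpa using hxy
    have := rel_map (Sum.inr : B ⊕ A → C ⊕ B ⊕ A) h
    have := Setoid.le_def.1 (le_sup_right (a := (flipRel s).map (Sum.map id Sum.inl))) this
    rcases x with x | x <;> rcases y with y | y <;> exact this
  · intro x y hxy
    have h : (flipRel s) x.swap y.swap := by
      change s x.swap.swap y.swap.swap
      simpa using hxy
    have := rel_map (Sum.map id Sum.inl : C ⊕ B → C ⊕ B ⊕ A) h
    have := Setoid.le_def.1 (le_sup_left (b := (flipRel r).map Sum.inr)) this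
    rcases x with x | x <;> rcases y with y | y <;> exact this

theorem glue_flip (r : Setoid (A ⊕ B)) (s : Setoid (B ⊕ C)) :
    (glue (flipRel s) (flipRel r)).comap flip3 = glue r s := by
  refine le_antisymm ?_ (glue_le_flip r s)
  intro x y hxy
  have := glue_le_flip (flipRel s) (flipRel r) hxy
  change glue (flipRel (flipRel r)) (flipRel (flipRel s)) (flip3 (flip3 x)) (flip3 (flip3 y)) at this
  rw [flip3_flip3, flip3_flip3] at this
  have e : ∀ {A B : Type} (r : Setoid (A ⊕ B)), flipRel (flipRel r) = r := by
    intro A B r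
    ext x y
    change r x.swap.swap y.swap.swap ↔ r x y
    simp
  rwa [e, e] at this

theorem joinRel_flip (r : Setoid (A ⊕ B)) (s : Setoid (B ⊕ C)) :
    joinRel (flipRel s) (flipRel r) = flipRel (joinRel r s) := by
  rw [joinRel, joinRel, ← glue_flip r s]
  ext x y
  rcases x with x | x <;> rcases y with y | y <;> exact Iff.rfl

theorem joinLoops_flip [Finite A] [Finite B] [Finite C] (r : Setoid (A ⊕ B)) (s : Setoid (B ⊕ C)) :
    joinLoops (flipRel s) (flipRel r) = joinLoops r s := by
  have h1 := floating_add (glue r s) outer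
  have h2 := floating_add (glue (flipRel s) (flipRel r)) outer
  have hsurj : Function.Surjective (flip3 : A ⊕ B ⊕ C → C ⊕ B ⊕ A) := fun p => ⟨flip3 p, flip3_flip3 p⟩
  have h3 := Nat.card_congr (Setoid.comapQuotientEquiv flip3 (glue (flipRel s) (flipRel r)))
  have h4 : Set.range (Quotient.mk'' (s₁ := glue (flipRel s) (flipRel r)) ∘ flip3) = Set.univ :=
    Set.range_eq_univ.2 (Quotient.mk''_surjective.comp hsurj)
  rw [glue_flip, h4, Nat.card_univ] at h3
  have h5 : Nat.card (Quotient (joinRel (flipRel s) (flipRel r))) =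
      Nat.card (Quotient (joinRel r s)) := by
    rw [joinRel_flip]
    refine Nat.card_congr (Quotient.congr (Equiv.sumComm C A) ?_)
    intro a b
    exact Iff.rfl
  unfold joinRel at h5
  unfold joinLoops
  omega

end Flip

section Identity

/-- Two copies of `A`, each point joined to its twin. -/
def idRel (A : Type) : Setoid (A ⊕ A) := Setoid.ker (Sum.elim id id)

theorem glue_id_le (r : Setoid (A ⊕ B)) :
    glue (idRel A) r ≤ r.comap (Sum.elim Sum.inl id) := by
  rw [glue, sup_le_iff, map_le_iff, map_le_iff]
  constructor
  · intro x y hxy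
    have hxy : Sum.elim id id x = Sum.elim id id y := hxy
    have e : ∀ z : A ⊕ A, (Sum.elim Sum.inl id (Sum.map id Sum.inl z : A ⊕ A ⊕ B)) =
        (Sum.inl (Sum.elim id id z) : A ⊕ B) := by
      rintro (z | z) <;> rfl
    change r _ _
    rw [e, e, hxy]
  · intro x y hxy
    exact hxy

theorem id_joinRel (r : Setoid (A ⊕ B)) : joinRel (idRel A) r = r := by
  apply le_antisymm
  · intro x y hxy
    have := glue_id_le r hxy
    rcases x with x | x <;> rcases y with y | y <;> exact this
  · intro x y hxy
    have h1 : glue (idRel A) r (Sum.inr x) (Sum.inr y) :=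
      Setoid.le_def.1 le_sup_right (rel_map Sum.inr hxy)
    have h2 : ∀ z : A ⊕ B, glue (idRel A) r (outer z) (Sum.inr z) := by
      rintro (a | b)
      · refine Setoid.le_def.1 le_sup_left
          (rel_map (Sum.map id Sum.inl : A ⊕ A → A ⊕ A ⊕ B) (x := Sum.inl a) (y := Sum.inr a) ?_)
        rfl
      · exact (glue (idRel A) r).refl _
    exact (glue (idRel A) r).trans (h2 x)
      ((glue (idRel A) r).trans h1 ((glue (idRel A) r).symm (h2 y)))

theorem id_joinLoops (r : Setoid (A ⊕ B)) : joinLoops (idRel A) r = 0 := by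
  have : IsEmpty {c : Quotient (glue (idRel A) r) // ∀ o, Quotient.mk _ (outer o) ≠ c} := by
    refine ⟨?_⟩
    rintro ⟨c, hc⟩
    induction c using Quotient.inductionOn with
    | _ x =>
      rcases x with a | a | b
      · exact hc (Sum.inl a) rfl
      · refine hc (Sum.inl a) (Quotient.sound (Setoid.le_def.1 le_sup_left
          (rel_map (Sum.map id Sum.inl : A ⊕ A → A ⊕ A ⊕ B) (x := Sum.inl a) (y := Sum.inr a) ?_)))
        rfl
      · exact hc (Sum.inr b) rfl
  exact Nat.card_of_isEmpty

theorem flipRel_id : flipRel (idRel A) = idRel A := by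
  ext x y
  change Sum.elim id id x.swap = Sum.elim id id y.swap ↔ Sum.elim id id x = Sum.elim id id y
  rcases x with x | x <;> rcases y with y | y <;> exact Iff.rfl

theorem joinRel_id (r : Setoid (A ⊕ B)) : joinRel r (idRel B) = r := by
  have e : ∀ {A B : Type} (r : Setoid (A ⊕ B)), flipRel (flipRel r) = r := by
    intro A B r
    ext x y
    change r x.swap.swap y.swap.swap ↔ r x y
    simp
  have h := joinRel_flip (flipRel (idRel B)) (flipRel r)
  rw [e, e, flipRel_id, id_joinRel, e] at h
  exact h

theorem joinLoops_id [Finite A] [Finite B] (r : Setoid (A ⊕ B)) : joinLoops r (idRel B) = 0 := by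
  rw [← joinLoops_flip, flipRel_id, id_joinLoops]

end Identity

end Gluing

end TemperleyLieb

namespace TemperleyLieb

section Pairings

/-- Every class has exactly two elements. -/
def IsPairing {T : Type} (r : Setoid T) : Prop := ∀ p, ∃! q, q ≠ p ∧ r p q

variable {T : Type} {r : Setoid T}

/-- The other element of the class of `p`. -/
noncomputable def IsPairing.partner (h : IsPairing r) (p : T) : T := (h p).choose

theorem IsPairing.partner_ne (h : IsPairing r) (p : T) : h.partner p ≠ p :=
  (h p).choose_spec.1.1

theorem IsPairing.rel_partner (h : IsPairing r) (p : T) : r p (h.partner p) :=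
  (h p).choose_spec.1.2

theorem IsPairing.eq_of_rel (h : IsPairing r) {p q : T} (hpq : r p q) (hne : q ≠ p) :
    q = h.partner p := (h p).choose_spec.2 q ⟨hne, hpq⟩

theorem IsPairing.partner_partner (h : IsPairing r) (p : T) : h.partner (h.partner p) = p :=
  (h.eq_of_rel (r.symm (h.rel_partner p)) (h.partner_ne p).symm).symm

theorem IsPairing.even_card (h : IsPairing r) (S : Finset T)
    (hS : ∀ p ∈ S, ∀ q, r p q → q ∈ S) : Even S.card := by
  have : ∑ p ∈ S, (1 : ZMod 2) = 0 := by
    refine Finset.sum_involution (fun p _ => h.partner p) ?_ ?_ ?_ ?_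
    · intro _ _; decide
    · intro p _ _; exact h.partner_ne p
    · intro p hp; exact hS p hp _ (h.rel_partner p)
    · intro p _; exact h.partner_partner p
  rw [Finset.sum_const, nsmul_eq_mul, mul_one] at this
  exact (ZMod.natCast_eq_zero_iff_even).1 this

theorem eq_of_two_ends {α : Type} [Finite α] (X Y : Equiv.Perm α) (hX : X * X = 1) (hY : Y * Y = 1)
    (a : α) (ha : Y a = a) (R : α → Prop)
    (hR : ∀ U : Set α, a ∈ U → (∀ p ∈ U, X p ∈ U ∧ Y p ∈ U) → ∀ q, R q → q ∈ U)
    (q₁ q₂ : α) (h₁ : R q₁) (h₂ : R q₂) (n₁ : q₁ ≠ a) (n₂ : q₂ ≠ a)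
    (e₁ : X q₁ = q₁ ∨ Y q₁ = q₁) (e₂ : X q₂ = q₂ ∨ Y q₂ = q₂) : q₁ = q₂ := by
  have hXi : X⁻¹ = X := inv_eq_of_mul_eq_one_right hX
  have hYi : Y⁻¹ = Y := inv_eq_of_mul_eq_one_right hY
  set f := Y * X with hf
  have hfi : f⁻¹ = X * Y := by rw [hf, mul_inv_rev, hXi, hYi]
  have hYf : ∀ i : ℤ, Y * f ^ i = f ^ (-i) * Y := by
    intro i
    have h : Y * f ^ i * Y⁻¹ = (Y * f * Y⁻¹) ^ i := (conj_zpow).symm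
    have h' : Y * f * Y⁻¹ = f⁻¹ := by
      rw [hfi, hYi, hf, ← mul_assoc, hY, one_mul]
    rw [h', inv_zpow', hYi] at h
    rw [← h, mul_assoc, hY, mul_one]
  have hXf : ∀ i : ℤ, X * f ^ i = f ^ (-i - 1) * Y := by
    intro i
    have : X = f⁻¹ * Y := by rw [hfi, mul_assoc, hY, mul_one]
    conv_lhs => rw [this]
    rw [mul_assoc, hYf, ← mul_assoc, ← zpow_neg_one, ← zpow_add]
    congr 2
    ring
  have hYa : ∀ i : ℤ, Y ((f ^ i) a) = (f ^ (-i)) a := by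
    intro i
    have := congrArg (fun g : Equiv.Perm α => g a) (hYf i)
    simpa [Equiv.Perm.mul_apply, ha] using this
  have hXa : ∀ i : ℤ, X ((f ^ i) a) = (f ^ (-i - 1)) a := by
    intro i
    have := congrArg (fun g : Equiv.Perm α => g a) (hXf i)
    simpa [Equiv.Perm.mul_apply, ha] using this
  have mem : ∀ q, R q → ∃ i : ℤ, (f ^ i) a = q := by
    intro q hq
    refine hR {q | ∃ i : ℤ, (f ^ i) a = q} ⟨0, rfl⟩ ?_ q hq
    rintro p ⟨i, rfl⟩
    exact ⟨⟨-i - 1, (hXa i).symm⟩, ⟨-i, (hYa i).symm⟩⟩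
  set L : ℤ := ((Function.minimalPeriod (fun x => f • x) a : ℕ) : ℤ) with hL
  have key : ∀ i : ℤ, (f ^ i) a = a ↔ L ∣ i := fun i =>
    MulAction.zpow_smul_eq_iff_minimalPeriod_dvd (a := f) (b := a) (n := i)
  have key2 : ∀ i j : ℤ, (f ^ i) a = (f ^ j) a ↔ L ∣ i - j := by
    intro i j
    rw [← key, sub_eq_neg_add, zpow_add, zpow_neg, Equiv.Perm.mul_apply, Equiv.Perm.inv_eq_iff_eq]
  obtain ⟨i, rfl⟩ := mem q₁ h₁
  obtain ⟨j, rfl⟩ := mem q₂ h₂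
  rw [Ne, key] at n₁ n₂
  rw [hXa, hYa, key2, key2] at e₁ e₂
  rw [key2]
  have ends : ∀ i : ℤ, ¬ L ∣ i → (L ∣ -i - 1 - i ∨ L ∣ -i - i) →
      (Odd L ∧ L ∣ 2 * i + 1) ∨ (Even L ∧ ∃ u, 2 * i = L * (2 * u + 1)) := by
    rintro i hi (⟨u, hu⟩ | ⟨u, hu⟩)
    · left
      have e : 2 * i + 1 = L * (-u) := by linarith
      refine ⟨?_, ⟨-u, e⟩⟩
      have : Odd (L * (-u)) := by rw [← e]; exact ⟨i, rfl⟩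
      exact (Int.odd_mul.1 this).1
    · right
      rcases Int.even_or_odd' (-u) with ⟨v, hv | hv⟩
      · have e : 2 * i = 2 * (L * v) := by linear_combination -hu + L * hv
        exact absurd ⟨v, by linarith⟩ hi
      · have e : 2 * i = L * (2 * v + 1) := by rw [← hv]; linarith
        refine ⟨?_, v, e⟩
        have : Even (L * (2 * v + 1)) := by rw [← e]; exact even_two_mul i
        rcases Int.even_mul.1 this with h | h
        · exact h
        · exact absurd h (by simp)
  rcases ends i n₁ e₁ with ⟨o₁, d₁⟩ | ⟨o₁, u, hu⟩ <;> rcases ends j n₂ e₂ with ⟨o₂, d₂⟩ | ⟨o₂, v, hv⟩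
  · have h : L ∣ 2 * (i - j) := by
      have := dvd_sub d₁ d₂
      ring_nf at this ⊢
      exact this
    obtain ⟨w, hw⟩ := o₁
    have cop : IsCoprime L 2 := ⟨1, -w, by rw [hw]; ring⟩
    exact cop.dvd_of_dvd_mul_left h
  · exact absurd o₂ (Int.not_even_iff_odd.2 o₁)
  · exact absurd o₁ (Int.not_even_iff_odd.2 o₂)
  · refine ⟨u - v, ?_⟩
    have : 2 * (i - j) = 2 * (L * (u - v)) := by linear_combination hu - hv
    linarith

section Join

variable {A B C : Type} {r : Setoid (A ⊕ B)} {s : Setoid (B ⊕ C)}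

/-- Follow an arc of the left-hand picture. -/
noncomputable def stepL (hr : IsPairing r) : A ⊕ B ⊕ C → A ⊕ B ⊕ C
  | Sum.inl a => Sum.map id Sum.inl (hr.partner (Sum.inl a))
  | Sum.inr (Sum.inl b) => Sum.map id Sum.inl (hr.partner (Sum.inr b))
  | Sum.inr (Sum.inr c) => Sum.inr (Sum.inr c)

/-- Follow an arc of the right-hand picture. -/
noncomputable def stepR (hs : IsPairing s) : A ⊕ B ⊕ C → A ⊕ B ⊕ C
  | Sum.inl a => Sum.inl a
  | Sum.inr z => Sum.inr (hs.partner z)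

theorem stepL_map (hr : IsPairing r) (z : A ⊕ B) :
    stepL (C := C) hr (Sum.map id Sum.inl z) = Sum.map id Sum.inl (hr.partner z) := by
  rcases z with z | z <;> rfl

theorem stepL_invol (hr : IsPairing r) : Function.Involutive (stepL (C := C) hr) := by
  intro p
  rcases p with a | b | c
  · change stepL hr (Sum.map id Sum.inl (hr.partner (Sum.inl a))) = _
    rw [stepL_map, hr.partner_partner]; rfl
  · change stepL hr (Sum.map id Sum.inl (hr.partner (Sum.inr b))) = _
    rw [stepL_map, hr.partner_partner]; rfl
  · rfl

theorem stepR_invol (hs : IsPairing s) : Function.Involutive (stepR (A := A) hs) := by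
  intro p
  rcases p with a | z
  · rfl
  · change Sum.inr (hs.partner (hs.partner z)) = _
    rw [hs.partner_partner]

theorem glue_subset (hr : IsPairing r) (hs : IsPairing s) (U : Set (A ⊕ B ⊕ C))
    (hU : ∀ p ∈ U, stepL hr p ∈ U ∧ stepR hs p ∈ U) {p q : A ⊕ B ⊕ C} (hp : p ∈ U)
    (h : glue r s p q) : q ∈ U := by
  have hle : glue r s ≤ Setoid.ker (· ∈ U) := by
    rw [glue, sup_le_iff, map_le_iff, map_le_iff]
    constructor
    · intro x y hxy
      by_cases hne : y = x
      · rw [hne]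
      · have e := hr.eq_of_rel hxy hne
        have e' : x = hr.partner y := by rw [e, hr.partner_partner]
        refine propext ⟨fun hx => ?_, fun hy => ?_⟩
        · have := (hU _ hx).1
          rwa [stepL_map, ← e] at this
        · have := (hU _ hy).1
          rwa [stepL_map, ← e'] at this
    · intro x y hxy
      by_cases hne : y = x
      · rw [hne]
      · have e := hs.eq_of_rel hxy hne
        have e' : x = hs.partner y := by rw [e, hs.partner_partner]
        refine propext ⟨fun hx => ?_, fun hy => ?_⟩
        · have : Sum.inr (hs.partner x) ∈ U := (hU _ hx).2
          rwa [← e] at this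
        · have : Sum.inr (hs.partner y) ∈ U := (hU _ hy).2
          rwa [← e'] at this
  have : (p ∈ U) = (q ∈ U) := hle h
  rwa [← this]

theorem outer_injective : Function.Injective (outer : A ⊕ C → A ⊕ B ⊕ C) :=
  Function.Injective.sumMap Function.injective_id Sum.inr_injective

theorem join_unique [Finite A] [Finite B] [Finite C] (hr : IsPairing r) (hs : IsPairing s)
    {p q q' : A ⊕ C} (h : joinRel r s p q) (h' : joinRel r s p q') (n : q ≠ p) (n' : q' ≠ p) :
    q = q' := by
  set X : Equiv.Perm (A ⊕ B ⊕ C) := (stepL_invol (C := C) hr).toPerm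
  set Y : Equiv.Perm (A ⊕ B ⊕ C) := (stepR_invol (A := A) hs).toPerm
  have hX : X * X = 1 := Equiv.ext (stepL_invol hr)
  have hY : Y * Y = 1 := Equiv.ext (stepR_invol hs)
  have ends : ∀ z : A ⊕ C, X (outer z) = outer z ∨ Y (outer z) = outer z := by
    rintro (a | c)
    · exact Or.inr rfl
    · exact Or.inl rfl
  apply outer_injective (B := B)
  have n₁ : outer (B := B) q ≠ outer p := fun e => n (outer_injective e)
  have n₂ : outer (B := B) q' ≠ outer p := fun e => n' (outer_injective e)
  rcases p with a | c
  · exact eq_of_two_ends X Y hX hY (outer (Sum.inl a)) rfl (fun q => glue r s (outer (Sum.inl a)) q)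
      (fun U ha hU q hq => glue_subset hr hs U hU ha hq) _ _ h h' n₁ n₂ (ends q) (ends q')
  · exact eq_of_two_ends Y X hY hX (outer (Sum.inr c)) rfl (fun q => glue r s (outer (Sum.inr c)) q)
      (fun U ha hU q hq => glue_subset hr hs U (fun p hp => (hU p hp).symm) ha hq) _ _ h h' n₁ n₂
      (ends q).symm (ends q').symm

theorem card_sum_filter {A B : Type} [Fintype A] [Fintype B] (P : A ⊕ B → Prop)
    [DecidablePred P] :
    (Finset.univ.filter P).card = (Finset.univ.filter fun a => P (Sum.inl a)).card +
      (Finset.univ.filter fun b => P (Sum.inr b)).card := by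
  simp only [Finset.card_filter, Fintype.sum_sum_type]

open Classical in
theorem even_outer [Fintype A] [Fintype B] [Fintype C] (hr : IsPairing r) (hs : IsPairing s)
    (P : A ⊕ B ⊕ C → Prop) (hP : ∀ p q, glue r s p q → P p → P q) :
    Even (Finset.univ.filter fun z : A ⊕ B => P (Sum.map id Sum.inl z)).card ∧
    Even (Finset.univ.filter fun z : B ⊕ C => P (Sum.inr z)).card ∧
    Even (Finset.univ.filter fun z : A ⊕ C => P (outer z)).card := by
  have h1 : Even (Finset.univ.filter fun z : A ⊕ B => P (Sum.map id Sum.inl z)).card := by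
    refine hr.even_card _ fun p hp q hpq => ?_
    rw [Finset.mem_filter] at hp ⊢
    exact ⟨Finset.mem_univ _, hP _ _ (Setoid.le_def.1 le_sup_left (rel_map _ hpq)) hp.2⟩
  have h2 : Even (Finset.univ.filter fun z : B ⊕ C => P (Sum.inr z)).card := by
    refine hs.even_card _ fun p hp q hpq => ?_
    rw [Finset.mem_filter] at hp ⊢
    exact ⟨Finset.mem_univ _, hP _ _ (Setoid.le_def.1 le_sup_right (rel_map _ hpq)) hp.2⟩
  refine ⟨h1, h2, ?_⟩
  rw [card_sum_filter] at h1 h2 ⊢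
  have h1 : Even ((Finset.univ.filter fun a : A => P (Sum.inl a)).card +
    (Finset.univ.filter fun b : B => P (Sum.inr (Sum.inl b))).card) := h1
  have h2 : Even ((Finset.univ.filter fun b : B => P (Sum.inr (Sum.inl b))).card +
    (Finset.univ.filter fun c : C => P (Sum.inr (Sum.inr c))).card) := h2
  change Even ((Finset.univ.filter fun a : A => P (Sum.inl a)).card +
    (Finset.univ.filter fun c : C => P (Sum.inr (Sum.inr c))).card)
  rw [Nat.even_iff] at *
  omega

theorem joinRel_pairing [Finite A] [Finite B] [Finite C] (hr : IsPairing r) (hs : IsPairing s) :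
    IsPairing (joinRel r s) := by
  classical
  have := Fintype.ofFinite A
  have := Fintype.ofFinite B
  have := Fintype.ofFinite C
  intro p
  have hev := (even_outer hr hs (fun q => glue r s (outer p) q)
    (fun x y hxy hx => (glue r s).trans hx hxy)).2.2
  have hp : p ∈ Finset.univ.filter fun z : A ⊕ C => glue r s (outer p) (outer z) := by
    rw [Finset.mem_filter]
    exact ⟨Finset.mem_univ _, (glue r s).refl _⟩
  have hlt : 1 < (Finset.univ.filter fun z : A ⊕ C => glue r s (outer p) (outer z)).card := by
    have := Finset.card_pos.2 ⟨p, hp⟩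
    rw [Nat.even_iff] at hev
    omega
  obtain ⟨q, hq, hne⟩ := Finset.exists_mem_ne hlt p
  rw [Finset.mem_filter] at hq
  exact ⟨q, ⟨hne, hq.2⟩, fun q' hq' => join_unique hr hs hq'.2 hq.2 hq'.1 hne⟩

end Join

end Pairings

section Planarity

/-- The position of a site on the boundary of the strip: down the left-hand column, then up the
right-hand one. -/
def bdry {n m : ℕ} : Fin n ⊕ Fin m → ℕ :=
  Sum.elim (fun i => (i : ℕ)) (fun j => n + m - 1 - (j : ℕ))

/-- No two arcs cross. -/
def IsPlanar {n m : ℕ} (r : Setoid (Fin n ⊕ Fin m)) : Prop :=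
  ∀ a b c d, bdry a < bdry b → bdry b < bdry c → bdry c < bdry d → r a c → ¬ r b d

variable {n k m : ℕ}

theorem bdry_injective : Function.Injective (bdry : Fin n ⊕ Fin m → ℕ) := by
  rintro (i | j) (i' | j') h
  · exact congrArg Sum.inl (Fin.ext h)
  · have h : (i : ℕ) = n + m - 1 - j' := h
    omega
  · have h : n + m - 1 - (j : ℕ) = i' := h
    omega
  · have h : n + m - 1 - (j : ℕ) = n + m - 1 - j' := h
    exact congrArg Sum.inr (Fin.ext (by omega))

open Classical in
/-- The number of points of `P` above a site in its column. -/
noncomputable def above (P : Fin n → Prop) (i : Fin n) : ℕ :=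
  (Finset.univ.filter fun i' => i' < i ∧ P i').card

open Classical in
/-- The number of points of `P` before a site on the boundary. -/
noncomputable def before (P : Fin n ⊕ Fin m → Prop) (u : Fin n ⊕ Fin m) : ℕ :=
  (Finset.univ.filter fun q => bdry q < bdry u ∧ P q).card

open Classical in
theorem above_before (P : Fin n ⊕ Fin m → Prop) (hP : Even (Finset.univ.filter P).card)
    (u : Fin n ⊕ Fin m) (hu : ¬ P u) :
    Sum.elim (above fun i => P (Sum.inl i)) (above fun j => P (Sum.inr j)) u % 2 =
      before P u % 2 := by
  rcases u with i | j
  · rw [before, card_sum_filter]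
    have : (Finset.univ.filter fun j : Fin m =>
        bdry (Sum.inr j : Fin n ⊕ Fin m) < bdry (Sum.inl i : Fin n ⊕ Fin m) ∧ P (Sum.inr j)) = ∅ := by
      refine Finset.filter_eq_empty_iff.2 fun j _ h => ?_
      have : n + m - 1 - (j : ℕ) < i := h.1
      omega
    rw [this, Finset.card_empty, add_zero]
    rfl
  · rw [before, card_sum_filter]
    rw [card_sum_filter] at hP
    have e1 : (Finset.univ.filter fun i : Fin n =>
        bdry (Sum.inl i : Fin n ⊕ Fin m) < bdry (Sum.inr j : Fin n ⊕ Fin m) ∧ P (Sum.inl i)) =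
        Finset.univ.filter fun i => P (Sum.inl i) := by
      refine Finset.filter_congr fun i _ => ?_
      have : bdry (Sum.inl i : Fin n ⊕ Fin m) < bdry (Sum.inr j : Fin n ⊕ Fin m) := by
        change (i : ℕ) < n + m - 1 - (j : ℕ)
        omega
      simp [this]
    have e2 : (Finset.univ.filter fun j' : Fin m => P (Sum.inr j')) =
        (Finset.univ.filter fun j' : Fin m => j' < j ∧ P (Sum.inr j')) ∪
        (Finset.univ.filter fun j' : Fin m =>
          bdry (Sum.inr j' : Fin n ⊕ Fin m) < bdry (Sum.inr j : Fin n ⊕ Fin m) ∧ P (Sum.inr j')) := by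
      ext j'
      simp only [Finset.mem_filter, Finset.mem_union, Finset.mem_univ, true_and]
      constructor
      · intro h
        have hne : j' ≠ j := fun e => hu (e ▸ h)
        rcases lt_or_gt_of_ne hne with hlt | hlt
        · exact Or.inl ⟨hlt, h⟩
        · refine Or.inr ⟨?_, h⟩
          change n + m - 1 - (j' : ℕ) < n + m - 1 - (j : ℕ)
          have : (j : ℕ) < j' := hlt
          omega
      · rintro (h | h) <;> exact h.2
    have hd : Disjoint (Finset.univ.filter fun j' : Fin m => j' < j ∧ P (Sum.inr j'))
        (Finset.univ.filter fun j' : Fin m =>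
          bdry (Sum.inr j' : Fin n ⊕ Fin m) < bdry (Sum.inr j : Fin n ⊕ Fin m) ∧ P (Sum.inr j')) := by
      refine Finset.disjoint_filter.2 ?_
      rintro j' - ⟨h1, -⟩ ⟨h2, -⟩
      have h1 : (j' : ℕ) < j := h1
      have h2 : n + m - 1 - (j' : ℕ) < n + m - 1 - (j : ℕ) := h2
      omega
    have e3 := congrArg Finset.card e2
    rw [Finset.card_union_of_disjoint hd] at e3
    rw [e1]
    change (Finset.univ.filter fun j' : Fin m => j' < j ∧ P (Sum.inr j')).card % 2 = _
    rw [Nat.even_iff] at hP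
    omega

open Classical in
theorem before_congr_of_lt {r : Setoid (Fin n ⊕ Fin m)} (hr : IsPairing r) (hpl : IsPlanar r)
    (P : Fin n ⊕ Fin m → Prop) (hP : ∀ p q, r p q → P p → P q) (u v : Fin n ⊕ Fin m)
    (hu : ¬ P u) (huv : r u v) (hlt : bdry u < bdry v) : before P u % 2 = before P v % 2 := by
  have hv : ¬ P v := fun h => hu (hP _ _ (r.symm huv) h)
  have e : (Finset.univ.filter fun q => bdry q < bdry v ∧ P q) =
      (Finset.univ.filter fun q => bdry q < bdry u ∧ P q) ∪
      (Finset.univ.filter fun q => (bdry u < bdry q ∧ bdry q < bdry v) ∧ P q) := by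
    ext q
    simp only [Finset.mem_filter, Finset.mem_union, Finset.mem_univ, true_and]
    constructor
    · rintro ⟨h1, h2⟩
      have hne : bdry q ≠ bdry u := fun e => hu (bdry_injective e ▸ h2)
      rcases lt_or_gt_of_ne hne with h | h
      · exact Or.inl ⟨h, h2⟩
      · exact Or.inr ⟨⟨h, h1⟩, h2⟩
    · rintro (⟨h1, h2⟩ | ⟨⟨h1, h2⟩, h3⟩)
      · exact ⟨h1.trans hlt, h2⟩
      · exact ⟨h2, h3⟩
  have hd : Disjoint (Finset.univ.filter fun q => bdry q < bdry u ∧ P q)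
      (Finset.univ.filter fun q => (bdry u < bdry q ∧ bdry q < bdry v) ∧ P q) := by
    refine Finset.disjoint_filter.2 ?_
    rintro q - ⟨h1, -⟩ ⟨⟨h2, -⟩, -⟩
    omega
  have hev : Even (Finset.univ.filter fun q => (bdry u < bdry q ∧ bdry q < bdry v) ∧ P q).card := by
    refine hr.even_card _ fun p hp q hpq => ?_
    simp only [Finset.mem_filter, Finset.mem_univ, true_and] at hp ⊢
    have hq := hP p q hpq hp.2
    have h1 : bdry q ≠ bdry u := fun e => hu (bdry_injective e ▸ hq)
    have h2 : bdry q ≠ bdry v := fun e => hv (bdry_injective e ▸ hq)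
    refine ⟨⟨?_, ?_⟩, hq⟩
    · by_contra hc
      exact hpl q u p v (by omega) hp.1.1 hp.1.2 (r.symm hpq) huv
    · by_contra hc
      exact hpl u p v q hp.1.1 hp.1.2 (by omega) huv hpq
  have e3 := congrArg Finset.card e
  rw [Finset.card_union_of_disjoint hd] at e3
  rw [Nat.even_iff] at hev
  unfold before
  omega

theorem before_congr {r : Setoid (Fin n ⊕ Fin m)} (hr : IsPairing r) (hpl : IsPlanar r)
    (P : Fin n ⊕ Fin m → Prop) (hP : ∀ p q, r p q → P p → P q) (u v : Fin n ⊕ Fin m)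
    (hu : ¬ P u) (huv : r u v) : before P u % 2 = before P v % 2 := by
  rcases lt_trichotomy (bdry u) (bdry v) with h | h | h
  · exact before_congr_of_lt hr hpl P hP u v hu huv h
  · rw [bdry_injective h]
  · exact (before_congr_of_lt hr hpl P hP v u (fun h => hu (hP _ _ (r.symm huv) h))
      (r.symm huv) h).symm

theorem joinRel_planar {r : Setoid (Fin n ⊕ Fin k)} {s : Setoid (Fin k ⊕ Fin m)}
    (hr : IsPairing r) (hs : IsPairing s) (pr : IsPlanar r) (ps : IsPlanar s) :
    IsPlanar (joinRel r s) := by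
  classical
  intro a b c d hab hbc hcd hac hbd
  let P : Fin n ⊕ Fin k ⊕ Fin m → Prop := fun q => glue r s (outer a) q
  have hP : ∀ p q, glue r s p q → P p → P q := fun p q hpq hp => (glue r s).trans hp hpq
  obtain ⟨ev1, ev2, ev3⟩ := even_outer hr hs P hP
  let col : Fin n ⊕ Fin k ⊕ Fin m → ℕ :=
    Sum.elim (above fun i => P (Sum.inl i)) (Sum.elim (above fun j => P (Sum.inr (Sum.inl j)))
      (above fun j => P (Sum.inr (Sum.inr j))))
  let κ : Fin n ⊕ Fin k ⊕ Fin m → Option ℕ := fun p => if P p then none else some (col p % 2)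
  have hle : glue r s ≤ Setoid.ker κ := by
    rw [glue, sup_le_iff, map_le_iff, map_le_iff]
    constructor
    · intro x y hxy
      have hg : glue r s (Sum.map id Sum.inl x) (Sum.map id Sum.inl y) :=
        Setoid.le_def.1 le_sup_left (rel_map _ hxy)
      change κ _ = κ _
      by_cases hx : P (Sum.map id Sum.inl x)
      · simp only [κ, if_pos hx, if_pos (hP _ _ hg hx)]
      · have hy : ¬ P (Sum.map id Sum.inl y) := fun h => hx (hP _ _ ((glue r s).symm hg) h)
        simp only [κ, if_neg hx, if_neg hy]
        congr 1
        have h1 := above_before (fun z : Fin n ⊕ Fin k => P (Sum.map id Sum.inl z)) ev1 x hx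
        have h2 := above_before (fun z : Fin n ⊕ Fin k => P (Sum.map id Sum.inl z)) ev1 y hy
        have h3 := before_congr hr pr (fun z : Fin n ⊕ Fin k => P (Sum.map id Sum.inl z))
          (fun p q hpq hp => hP _ _ (Setoid.le_def.1 le_sup_left (rel_map _ hpq)) hp) x y hx hxy
        rw [← h1, ← h2] at h3
        rcases x with x | x <;> rcases y with y | y <;> exact h3
    · intro x y hxy
      have hg : glue r s (Sum.inr x) (Sum.inr y) :=
        Setoid.le_def.1 le_sup_right (rel_map _ hxy)
      change κ _ = κ _
      by_cases hx : P (Sum.inr x)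
      · simp only [κ, if_pos hx, if_pos (hP _ _ hg hx)]
      · have hy : ¬ P (Sum.inr y) := fun h => hx (hP _ _ ((glue r s).symm hg) h)
        simp only [κ, if_neg hx, if_neg hy]
        congr 1
        have h1 := above_before (fun z : Fin k ⊕ Fin m => P (Sum.inr z)) ev2 x hx
        have h2 := above_before (fun z : Fin k ⊕ Fin m => P (Sum.inr z)) ev2 y hy
        have h3 := before_congr hs ps (fun z : Fin k ⊕ Fin m => P (Sum.inr z))
          (fun p q hpq hp => hP _ _ (Setoid.le_def.1 le_sup_right (rel_map _ hpq)) hp) x y hx hxy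
        rw [← h1, ← h2] at h3
        rcases x with x | x <;> rcases y with y | y <;> exact h3
  have hout : ∀ z : Fin n ⊕ Fin m, P (outer z) ↔ z = a ∨ z = c := by
    intro z
    constructor
    · intro hz
      by_cases hza : z = a
      · exact Or.inl hza
      · refine Or.inr (join_unique hr hs hz hac hza ?_)
        rintro rfl
        omega
    · rintro (rfl | rfl)
      · exact (glue r s).refl _
      · exact hac
  have hb : ¬ P (outer b) := by
    rw [hout]
    rintro (rfl | rfl) <;> omega
  have hd : ¬ P (outer d) := by
    rw [hout]
    rintro (rfl | rfl) <;> omega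
  have hκ : κ (outer b) = κ (outer d) := hle hbd
  simp only [κ, if_neg hb, if_neg hd] at hκ
  have hκ := Option.some_injective _ hκ
  have h1 := above_before (fun z : Fin n ⊕ Fin m => P (outer z)) ev3 b hb
  have h2 := above_before (fun z : Fin n ⊕ Fin m => P (outer z)) ev3 d hd
  have h3 : before (fun z : Fin n ⊕ Fin m => P (outer z)) b % 2 =
      before (fun z : Fin n ⊕ Fin m => P (outer z)) d % 2 := by
    rw [← h1, ← h2]
    rcases b with b | b <;> rcases d with d | d <;> exact hκ
  have cb : (Finset.univ.filter fun q : Fin n ⊕ Fin m => bdry q < bdry b ∧ P (outer q)) = {a} := by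
    ext q
    simp only [Finset.mem_filter, Finset.mem_univ, true_and, Finset.mem_singleton, hout]
    constructor
    · rintro ⟨h, rfl | rfl⟩
      · rfl
      · omega
    · rintro rfl
      exact ⟨hab, Or.inl rfl⟩
  have cd : (Finset.univ.filter fun q : Fin n ⊕ Fin m => bdry q < bdry d ∧ P (outer q)) =
      {a, c} := by
    ext q
    simp only [Finset.mem_filter, Finset.mem_univ, true_and, Finset.mem_singleton, hout,
      Finset.mem_insert]
    constructor
    · rintro ⟨-, h⟩
      exact h
    · rintro (rfl | rfl)
      · exact ⟨by omega, Or.inl rfl⟩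
      · exact ⟨hcd, Or.inr rfl⟩
  have hne : a ≠ c := by
    rintro rfl
    omega
  unfold before at h3
  rw [cb, cd, Finset.card_singleton, Finset.card_pair hne] at h3
  omega

end Planarity

end TemperleyLieb

namespace TemperleyLieb

section Diagrams

/-- An `(n, m)`-diagram: `n` source sites and `m` target sites, paired by non-crossing lines in the
strip between the two columns. Sites are numbered from top to bottom; `rel` says that two sites are
equal or are the two ends of a line. -/
@[ext]
structure Diagram (n m : ℕ) where
  rel : Setoid (Fin n ⊕ Fin m)
  pairing : IsPairing rel
  planar : IsPlanar rel

variable {n k m l : ℕ}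

theorem idRel_pairing {A : Type} : IsPairing (idRel A) := by
  rintro (a | a)
  · refine ⟨Sum.inr a, ⟨by simp, rfl⟩, ?_⟩
    rintro (b | b) ⟨h1, h2⟩
    · exact absurd (congrArg Sum.inl (show a = b from h2)).symm h1
    · exact (congrArg Sum.inr (show a = b from h2)).symm
  · refine ⟨Sum.inl a, ⟨by simp, rfl⟩, ?_⟩
    rintro (b | b) ⟨h1, h2⟩
    · exact (congrArg Sum.inl (show a = b from h2)).symm
    · exact absurd (congrArg Sum.inr (show a = b from h2)).symm h1

theorem idRel_planar : IsPlanar (idRel (Fin n)) := by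
  intro a b c d hab hbc hcd hac hbd
  have hac : Sum.elim id id a = Sum.elim id id c := hac
  have hbd : Sum.elim id id b = Sum.elim id id d := hbd
  rcases a with a | a <;> rcases b with b | b <;> rcases c with c | c <;> rcases d with d | d <;>
    simp only [bdry, Sum.elim_inl, Sum.elim_inr, id] at * <;> subst hac <;> subst hbd <;> omega

/-- The diagram with `n` through lines. -/
def Diagram.id (n : ℕ) : Diagram n n := ⟨idRel (Fin n), idRel_pairing, idRel_planar⟩

/-- Place `x` to the left of `y`, identify the target sites of `x` with the source sites of `y`,
and forget the closed loops. -/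
def Diagram.comp (x : Diagram n k) (y : Diagram k m) : Diagram n m :=
  ⟨joinRel x.rel y.rel, joinRel_pairing x.pairing y.pairing,
    joinRel_planar x.pairing y.pairing x.planar y.planar⟩

/-- The number of closed loops formed when `x` is composed with `y`. -/
noncomputable def Diagram.loops (x : Diagram n k) (y : Diagram k m) : ℕ := joinLoops x.rel y.rel

theorem flipRel_pairing {A B : Type} {r : Setoid (A ⊕ B)} (h : IsPairing r) :
    IsPairing (flipRel r) := by
  intro p
  refine ⟨(h.partner p.swap).swap, ⟨?_, ?_⟩, ?_⟩
  · intro e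
    refine h.partner_ne p.swap ?_
    have := congrArg Sum.swap e
    rwa [Sum.swap_swap] at this
  · change r p.swap (h.partner p.swap).swap.swap
    rw [Sum.swap_swap]
    exact h.rel_partner _
  · rintro q ⟨h1, h2⟩
    have := h.eq_of_rel (p := p.swap) (q := q.swap) h2
      (fun e => h1 (by rw [← Sum.swap_swap q, e, Sum.swap_swap]))
    rw [← this, Sum.swap_swap]

theorem bdry_swap (p : Fin n ⊕ Fin m) : bdry p.swap + bdry p + 1 = n + m := by
  rcases p with p | p <;> simp only [bdry, Sum.swap, Sum.elim_inl, Sum.elim_inr] <;> omega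

theorem flipRel_planar {r : Setoid (Fin n ⊕ Fin m)} (h : IsPlanar r) : IsPlanar (flipRel r) := by
  intro a b c d hab hbc hcd hac hbd
  have ha := bdry_swap a
  have hb := bdry_swap b
  have hc := bdry_swap c
  have hd := bdry_swap d
  exact h d.swap c.swap b.swap a.swap (by omega) (by omega) (by omega)
    (r.symm hbd) (r.symm hac)

/-- The reflection of a diagram in a vertical line, exchanging its two columns. -/
def Diagram.flip (x : Diagram n m) : Diagram m n :=
  ⟨flipRel x.rel, flipRel_pairing x.pairing, flipRel_planar x.planar⟩

theorem Diagram.flip_flip (x : Diagram n m) : x.flip.flip = x := by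
  ext p q
  change x.rel p.swap.swap q.swap.swap ↔ x.rel p q
  simp

theorem Diagram.flip_id : (Diagram.id n).flip = Diagram.id n := Diagram.ext flipRel_id

theorem Diagram.flip_comp (x : Diagram n k) (y : Diagram k m) :
    (x.comp y).flip = y.flip.comp x.flip := Diagram.ext (joinRel_flip x.rel y.rel).symm

theorem Diagram.loops_flip (x : Diagram n k) (y : Diagram k m) :
    y.flip.loops x.flip = x.loops y := joinLoops_flip x.rel y.rel

theorem Diagram.id_comp (x : Diagram n m) : (Diagram.id n).comp x = x :=
  Diagram.ext (id_joinRel x.rel)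

theorem Diagram.comp_id (x : Diagram n m) : x.comp (Diagram.id m) = x :=
  Diagram.ext (joinRel_id x.rel)

theorem Diagram.comp_assoc (x : Diagram n k) (y : Diagram k m) (z : Diagram m l) :
    (x.comp y).comp z = x.comp (y.comp z) := Diagram.ext (joinRel_assoc x.rel y.rel z.rel)

theorem Diagram.loops_assoc (x : Diagram n k) (y : Diagram k m) (z : Diagram m l) :
    x.loops y + (x.comp y).loops z = y.loops z + x.loops (y.comp z) :=
  joinLoops_assoc x.rel y.rel z.rel

/-- The identity diagram does not factor through fewer points. -/
theorem Diagram.comp_ne_id (x : Diagram m k) (y : Diagram k m) (hk : k < m) :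
    x.comp y ≠ Diagram.id m := by
  intro h
  have hrel : ∀ p q, joinRel x.rel y.rel p q ↔ idRel (Fin m) p q := by
    intro p q
    have := congrArg Diagram.rel h
    change joinRel x.rel y.rel = idRel (Fin m) at this
    rw [this]
  have hx : ∀ p q : Fin m ⊕ Fin k, x.rel p q →
      glue x.rel y.rel (Sum.map _root_.id Sum.inl p) (Sum.map _root_.id Sum.inl q) := fun p q hpq =>
    Setoid.le_def.1 le_sup_left (rel_map _ hpq)
  have hmid : ∀ i : Fin m, ∃ j : Fin k, x.pairing.partner (Sum.inl i) = Sum.inr j := by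
    intro i
    rcases e : x.pairing.partner (Sum.inl i) with i' | j
    · exfalso
      have h1 := x.pairing.rel_partner (Sum.inl i)
      rw [e] at h1
      have h2 : (idRel (Fin m)) (Sum.inl i) (Sum.inl i') := (hrel _ _).1 (hx _ _ h1)
      have h3 : i = i' := h2
      exact x.pairing.partner_ne (Sum.inl i) (by rw [e, h3])
    · exact ⟨j, rfl⟩
  choose g hg using hmid
  have hinj : Function.Injective g := by
    intro i i' hii
    have h1 : x.pairing.partner (Sum.inl i) = x.pairing.partner (Sum.inl i') := by
      rw [hg, hg, hii]
    have h2 := congrArg x.pairing.partner h1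
    rw [x.pairing.partner_partner, x.pairing.partner_partner] at h2
    exact Sum.inl_injective h2
  have := Fintype.card_le_of_injective g hinj
  simp only [Fintype.card_fin] at this
  omega

end Diagrams

section Category

variable {R : Type*} [CommRing R]

/-- The morphisms `n → m` of the Temperley--Lieb category over the pointed ring `(R, δ)`: formal
`R`-linear combinations of `(n, m)`-diagrams. -/
def Hom {R : Type*} [CommRing R] (_δ : R) (n m : ℕ) : Type _ := Diagram n m →₀ R

variable (δ : R) {n k m l : ℕ}

noncomputable instance : AddCommGroup (Hom δ n m) := inferInstanceAs (AddCommGroup (Diagram n m →₀ R))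

noncomputable instance : Module R (Hom δ n m) := inferInstanceAs (Module R (Diagram n m →₀ R))

/-- A diagram as a morphism. -/
noncomputable def Hom.of (x : Diagram n m) : Hom δ n m := Finsupp.single x 1

/-- The coefficient of a diagram in a morphism. -/
noncomputable def Hom.coeff (x : Diagram n m) : Hom δ n m →ₗ[R] R := Finsupp.lapply x

/-- Composition `n → k → m` in diagrammatic order: it is bilinear, and on diagrams every closed
loop is replaced by a factor `δ`. -/
noncomputable def Hom.comp : Hom δ n k →ₗ[R] Hom δ k m →ₗ[R] Hom δ n m :=
  Finsupp.linearCombination R (M := Hom δ k m →ₗ[R] Hom δ n m) fun x : Diagram n k =>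
    Finsupp.linearCombination R (M := Hom δ n m) fun y : Diagram k m =>
      δ ^ x.loops y • Hom.of δ (x.comp y)

/-- The duality `ι`, which reflects every diagram. -/
noncomputable def Hom.flip : Hom δ n m →ₗ[R] Hom δ m n :=
  Finsupp.linearCombination R (M := Hom δ m n) fun x : Diagram n m => Hom.of δ x.flip

theorem Hom.comp_of (x : Diagram n k) (y : Diagram k m) :
    Hom.comp δ (Hom.of δ x) (Hom.of δ y) = δ ^ x.loops y • Hom.of δ (x.comp y) := by
  unfold Hom.comp
  erw [Finsupp.linearCombination_single, one_smul, Finsupp.linearCombination_single, one_smul]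

theorem Hom.flip_of (x : Diagram n m) : Hom.flip δ (Hom.of δ x) = Hom.of δ x.flip := by
  unfold Hom.flip
  erw [Finsupp.linearCombination_single, one_smul]

theorem Hom.coeff_of_self (x : Diagram n m) : Hom.coeff δ x (Hom.of δ x) = 1 :=
  Finsupp.single_eq_same

theorem Hom.coeff_of_ne {x y : Diagram n m} (h : y ≠ x) : Hom.coeff δ x (Hom.of δ y) = 0 :=
  Finsupp.single_eq_of_ne h.symm

/-- Linear maps out of a morphism space are determined on diagrams. -/
theorem Hom.ext {M : Type*} [AddCommMonoid M] [Module R M] {f g : Hom δ n m →ₗ[R] M}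
    (h : ∀ x, f (Hom.of δ x) = g (Hom.of δ x)) : f = g :=
  Finsupp.lhom_ext' fun x => LinearMap.ext_ring (h x)

theorem Hom.comp_assoc (f : Hom δ n k) (g : Hom δ k m) (h : Hom δ m l) :
    Hom.comp δ (Hom.comp δ f g) h = Hom.comp δ f (Hom.comp δ g h) := by
  let L : Hom δ n k →ₗ[R] Hom δ k m →ₗ[R] Hom δ m l →ₗ[R] Hom δ n l :=
    (LinearMap.compr₂ (Hom.comp δ) (Hom.comp δ))
  let Q : Hom δ n k →ₗ[R] Hom δ k m →ₗ[R] Hom δ m l →ₗ[R] Hom δ n l :=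
    (LinearMap.llcomp R _ _ _).flip (Hom.comp δ) ∘ₗ (LinearMap.llcomp R _ _ _) ∘ₗ Hom.comp δ
  have : L = Q := by
    refine Hom.ext δ fun x => Hom.ext δ fun y => Hom.ext δ fun z => ?_
    change Hom.comp δ (Hom.comp δ (Hom.of δ x) (Hom.of δ y)) (Hom.of δ z) =
      Hom.comp δ (Hom.of δ x) (Hom.comp δ (Hom.of δ y) (Hom.of δ z))
    rw [Hom.comp_of, Hom.comp_of, map_smul, map_smul, LinearMap.smul_apply, Hom.comp_of,
      Hom.comp_of, smul_smul, smul_smul, ← pow_add, ← pow_add, Diagram.comp_assoc,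
      Diagram.loops_assoc]
  exact congrArg (fun F : Hom δ n k →ₗ[R] Hom δ k m →ₗ[R] Hom δ m l →ₗ[R] Hom δ n l => F f g h) this

theorem Hom.id_comp (f : Hom δ n m) : Hom.comp δ (Hom.of δ (Diagram.id n)) f = f := by
  have : Hom.comp δ (Hom.of δ (Diagram.id n)) = (LinearMap.id : Hom δ n m →ₗ[R] Hom δ n m) := by
    refine Hom.ext δ fun x => ?_
    have h : (Diagram.id n).loops x = 0 := id_joinLoops x.rel
    rw [Hom.comp_of, h, pow_zero, one_smul, Diagram.id_comp]
    rfl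
  exact congrArg (fun F : Hom δ n m →ₗ[R] Hom δ n m => F f) this

theorem Hom.comp_id (f : Hom δ n m) : Hom.comp δ f (Hom.of δ (Diagram.id m)) = f := by
  have : (Hom.comp δ).flip (Hom.of δ (Diagram.id m)) =
      (LinearMap.id : Hom δ n m →ₗ[R] Hom δ n m) := by
    refine Hom.ext δ fun x => ?_
    have h : x.loops (Diagram.id m) = 0 := joinLoops_id x.rel
    rw [LinearMap.flip_apply, Hom.comp_of, h, pow_zero, one_smul, Diagram.comp_id]
    rfl
  exact congrArg (fun F : Hom δ n m →ₗ[R] Hom δ n m => F f) this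

theorem Hom.flip_flip (f : Hom δ n m) : Hom.flip δ (Hom.flip δ f) = f := by
  have : Hom.flip δ ∘ₗ Hom.flip δ = (LinearMap.id : Hom δ n m →ₗ[R] Hom δ n m) := by
    refine Hom.ext δ fun x => ?_
    rw [LinearMap.comp_apply, Hom.flip_of, Hom.flip_of, Diagram.flip_flip]
    rfl
  exact congrArg (fun F : Hom δ n m →ₗ[R] Hom δ n m => F f) this

theorem Hom.flip_comp (f : Hom δ n k) (g : Hom δ k m) :
    Hom.flip δ (Hom.comp δ f g) = Hom.comp δ (Hom.flip δ g) (Hom.flip δ f) := by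
  have : (Hom.comp δ (n := n) (k := k) (m := m)).compr₂ (Hom.flip δ) =
      ((Hom.comp δ).compl₁₂ (Hom.flip δ) (Hom.flip δ)).flip := by
    refine Hom.ext δ fun x => Hom.ext δ fun y => ?_
    simp only [LinearMap.compr₂_apply, LinearMap.flip_apply, LinearMap.compl₁₂_apply]
    rw [Hom.comp_of, map_smul, Hom.flip_of, Hom.flip_of, Hom.flip_of, Hom.comp_of,
      Diagram.flip_comp, Diagram.loops_flip]
  exact congrArg (fun F : Hom δ n k →ₗ[R] Hom δ k m →ₗ[R] Hom δ m n => F f g) this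

theorem Hom.coeff_flip (f : Hom δ n n) :
    Hom.coeff δ (Diagram.id n) (Hom.flip δ f) = Hom.coeff δ (Diagram.id n) f := by
  have : Hom.coeff δ (Diagram.id n) ∘ₗ Hom.flip δ = Hom.coeff δ (Diagram.id n) := by
    refine Hom.ext δ fun x => ?_
    rw [LinearMap.comp_apply, Hom.flip_of]
    by_cases h : x = Diagram.id n
    · rw [h, Diagram.flip_id]
    · rw [Hom.coeff_of_ne δ h, Hom.coeff_of_ne]
      intro e
      exact h (by rw [← Diagram.flip_flip x, e, Diagram.flip_id])
  exact congrArg (fun F : Hom δ n n →ₗ[R] R => F f) this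

theorem Hom.coeff_comp (hk : k < m) (f : Hom δ m k) (g : Hom δ k m) :
    Hom.coeff δ (Diagram.id m) (Hom.comp δ f g) = 0 := by
  have : (Hom.comp δ (n := m) (k := k) (m := m)).compr₂ (Hom.coeff δ (Diagram.id m)) = 0 := by
    refine Hom.ext δ fun x => Hom.ext δ fun y => ?_
    rw [LinearMap.compr₂_apply, Hom.comp_of, map_smul, Hom.coeff_of_ne δ (x.comp_ne_id y hk)]
    exact smul_zero _
  exact congrArg (fun F : Hom δ m k →ₗ[R] Hom δ k m →ₗ[R] R => F f g) this

end Category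

section Algebra

variable {R : Type*} [CommRing R] (δ : R) (n m : ℕ)

/-- The Temperley--Lieb algebra `TL_n` over `(R, δ)`: the endomorphisms of the object `n`. -/
def TL : Type _ := Hom δ n n

noncomputable instance : AddCommGroup (TL δ n) := inferInstanceAs (AddCommGroup (Hom δ n n))

noncomputable instance : Module R (TL δ n) := inferInstanceAs (Module R (Hom δ n n))

noncomputable instance : Ring (TL δ n) :=
  { (inferInstance : AddCommGroup (TL δ n)) with
    mul := fun a b => Hom.comp δ (n := n) (k := n) (m := n) a b
    one := Hom.of δ (Diagram.id n)
    mul_assoc := fun a b c => Hom.comp_assoc δ a b c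
    one_mul := fun a => Hom.id_comp δ a
    mul_one := fun a => Hom.comp_id δ a
    left_distrib := fun a b c => map_add (Hom.comp δ (n := n) (k := n) (m := n) a) b c
    right_distrib := fun a b c => LinearMap.map_add₂ (Hom.comp δ) a b c
    zero_mul := fun a => LinearMap.map_zero₂ (Hom.comp δ) a
    mul_zero := fun a => map_zero (Hom.comp δ (n := n) (k := n) (m := n) a) }

noncomputable instance : Algebra R (TL δ n) :=
  Algebra.ofModule (fun c a b => LinearMap.map_smul₂ (Hom.comp δ) c a b)
    (fun c a b => map_smul (Hom.comp δ (n := n) (k := n) (m := n) a) c b)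

/-- The left action of `TL_n` on the morphisms `n → m` by composition. -/
noncomputable instance : Module (TL δ n) (Hom δ n m) where
  smul a f := Hom.comp δ (n := n) (k := n) (m := m) a f
  one_smul f := Hom.id_comp δ f
  mul_smul a b f := Hom.comp_assoc δ a b f
  smul_zero a := map_zero (Hom.comp δ (n := n) (k := n) (m := m) a)
  smul_add a f g := map_add (Hom.comp δ (n := n) (k := n) (m := m) a) f g
  add_smul a b f := LinearMap.map_add₂ (Hom.comp δ) a b f
  zero_smul f := LinearMap.map_zero₂ (Hom.comp δ) f

instance : IsScalarTower R (TL δ n) (Hom δ n m) :=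
  ⟨fun c a f => LinearMap.map_smul₂ (Hom.comp δ (n := n) (k := n) (m := m)) c a f⟩

/-- The submodule generated by the morphisms `n → m` that factor through some `i < m`. -/
noncomputable def lower : Submodule (TL δ n) (Hom δ n m) :=
  Submodule.span (TL δ n)
    {f | ∃ i < m, ∃ (g : Hom δ n i) (h : Hom δ i m), f = Hom.comp δ g h}

/-- The cell (or standard) module `S(n, m)` of `TL_n`. -/
abbrev CellModule : Type _ := Hom δ n m ⧸ lower δ n m

/-- The bilinear form on morphisms `n → m`: the coefficient of the identity diagram in `ι(x) y`. -/
noncomputable def homForm : Hom δ n m →ₗ[R] Hom δ n m →ₗ[R] R :=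
  ((Hom.comp δ).compr₂ (Hom.coeff δ (Diagram.id m))) ∘ₗ Hom.flip δ

theorem homForm_apply (x y : Hom δ n m) :
    homForm δ n m x y = Hom.coeff δ (Diagram.id m) (Hom.comp δ (Hom.flip δ x) y) := rfl

theorem homForm_symm (x y : Hom δ n m) : homForm δ n m x y = homForm δ n m y x := by
  rw [homForm_apply, homForm_apply, ← Hom.coeff_flip, Hom.flip_comp, Hom.flip_flip]

theorem homForm_smul (a : TL δ n) (x y : Hom δ n m) :
    homForm δ n m x (a • y) = homForm δ n m ((show TL δ n from Hom.flip δ (n := n) (m := n) a) • x) y := by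
  have key : ∀ b : Hom δ n n,
      Hom.coeff δ (Diagram.id m) (Hom.comp δ (Hom.flip δ x) (Hom.comp δ b y)) =
      Hom.coeff δ (Diagram.id m) (Hom.comp δ (Hom.flip δ (Hom.comp δ (Hom.flip δ b) x)) y) := by
    intro b
    rw [Hom.flip_comp, Hom.flip_flip, Hom.comp_assoc]
  exact key a

theorem homForm_lower {y : Hom δ n m} (hy : y ∈ lower δ n m) : ∀ x, homForm δ n m x y = 0 := by
  induction hy using Submodule.span_induction with
  | mem y hy =>
    obtain ⟨i, hi, g, h, rfl⟩ := hy
    intro x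
    rw [homForm_apply, ← Hom.comp_assoc, Hom.coeff_comp δ hi]
  | zero => intro x; exact map_zero _
  | add y z _ _ h1 h2 => intro x; rw [map_add, h1, h2, add_zero]
  | smul a y _ h => intro x; rw [homForm_smul, h]

/-- The standard form on `S(n, m)`. -/
noncomputable def cellForm : CellModule δ n m →ₗ[R] CellModule δ n m →ₗ[R] R :=
  let q := (lower δ n m).restrictScalars R
  let half : (Hom δ n m ⧸ q) →ₗ[R] Hom δ n m →ₗ[R] R :=
    q.liftQ (homForm δ n m) fun y hy => LinearMap.ext fun x => by
      rw [homForm_symm]; exact homForm_lower δ n m hy x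
  let full : (Hom δ n m ⧸ q) →ₗ[R] (Hom δ n m ⧸ q) →ₗ[R] R :=
    (q.liftQ half.flip fun y hy => LinearMap.ext fun x => by
      induction x using Submodule.Quotient.induction_on with
      | _ x => exact homForm_lower δ n m hy x).flip
  let e := (Submodule.Quotient.restrictScalarsEquiv R (lower δ n m)).symm.toLinearMap
  full.compl₁₂ e e

theorem cellForm_mk (x y : Hom δ n m) :
    cellForm δ n m (Submodule.Quotient.mk x) (Submodule.Quotient.mk y) = homForm δ n m x y := rfl

/-- The kernel `R(n, m)` of the standard form. -/
noncomputable def cellRadical : Submodule (TL δ n) (CellModule δ n m) where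
  carrier := {s | ∀ t, cellForm δ n m t s = 0}
  zero_mem' t := map_zero _
  add_mem' h1 h2 t := by rw [map_add, h1 t, h2 t, add_zero]
  smul_mem' a s h t := by
    induction s using Submodule.Quotient.induction_on with
    | _ y =>
    induction t using Submodule.Quotient.induction_on with
    | _ x =>
      rw [← Submodule.Quotient.mk_smul, cellForm_mk, homForm_smul, ← cellForm_mk]
      exact h _

/-- The module `D(n, m) = S(n, m) / R(n, m)`. Over a field it is simple or zero. -/
abbrev CellHead : Type _ := CellModule δ n m ⧸ cellRadical δ n m

end Algebra

section Linkage

/-- `N` is isomorphic to one of the successive quotients of a composition series of `M`. -/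
def IsCompositionFactor (A N M : Type*) [Ring A] [AddCommGroup N] [Module A N]
    [AddCommGroup M] [Module A M] : Prop :=
  ∃ s : CompositionSeries (Submodule A M), s.head = ⊥ ∧ s.last = ⊤ ∧
    ∃ i : Fin s.length, Nonempty (N ≃ₗ[A] (s i.succ ⧸ (s i.castSucc).submoduleOf (s i.succ)))

variable {R : Type*} [CommRing R] (δ : R)

/-- The quantum number `[n]`, evaluated at `δ`. -/
noncomputable def quantum (n : ℤ) : R := (Polynomial.Chebyshev.S R (n - 1)).eval δ

theorem quantum_zero : quantum δ 0 = 0 := by simp [quantum]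

theorem quantum_one : quantum δ 1 = 1 := by simp [quantum]

theorem quantum_rec (n : ℤ) : δ * quantum δ n = quantum δ (n + 1) + quantum δ (n - 1) := by
  have h := congrArg (Polynomial.eval δ) (Polynomial.Chebyshev.S_add_one R (n - 1))
  rw [Polynomial.eval_sub, Polynomial.eval_mul, Polynomial.eval_X] at h
  unfold quantum
  rw [show n + 1 - 1 = n - 1 + 1 by ring, h]
  ring

/-- The least positive `ℓ` with `[ℓ] = 0`. The value `0` stands for `ℓ = ∞`, the case in which no
such number exists; it has the same multiples, namely `0` alone. -/
noncomputable def ell : ℕ := sInf {k : ℕ | 0 < k ∧ quantum δ k = 0}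

/-- The group of permutations of `ℤ` generated by the reflections `x ↦ 2 c - x` about the integers
`c ≡ -1 (mod ℓ)`. -/
def reflectionGroup (ℓ : ℕ) : Subgroup (Equiv.Perm ℤ) :=
  Subgroup.closure {σ | ∃ c : ℤ, (ℓ : ℤ) ∣ c + 1 ∧ σ = Equiv.pointReflection c}

end Linkage

end TemperleyLieb

/-! Write `δ = q + r` with `q * r = 1` in an algebraic closure of `K`. The proof is a central
character argument. A closed strand encircling `n` through strands should slide off any arc, so the
element of `TL_n` it defines should commute past all cups and act on each cell module by a scalar,
namely `q ^ (m + 1) + r ^ (m + 1)` on `S(n, m)`. This is carried out algebraically: `casimir` is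
built from the sum of the Jucys–Murphy elements, `casimir_comp_cup` says that it passes through a
cup, and `casimir_comp_of_sub_mem_lowSpan` peels cups off a diagram until only the identity of `m`,
or a morphism through fewer points, is left.

The element has coefficients in the closure, whereas the modules live over `K`. The scalars are
polynomials in `δ`, hence lie in `K`, so a `K`-linear retraction of the closure onto `K`, applied to
the coefficients, yields an element of `TL_n` over `K` with the same action
(`exists_scalar_on_cells`).

A composition factor of a module is nonzero and is killed by whatever kills the module. Subtracting
its scalar on `S(n, m')` from the descended element gives something that kills `S(n, m')`, so the
scalars of `m` and `m'` agree (`IsCompositionFactor.cell_scalar_eq`). This equality factors as `(q ^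
(m - m') - 1) * (q ^ (m + m' + 2) - 1) = 0`. Both exponents are even, because diagrams exist only
between objects of equal parity, and `q ^ 2` has order `ℓ` (`ell_dvd`; here `δ ≠ ±2` is needed). The
first factor gives a translation in the reflection group and the second a reflection.

The inequality `m' ≤ m` is separate (`IsCompositionFactor.cell_le`). A nonzero value of the form on
`S(n, m)` makes some endomorphisms that factor through `m` act nontrivially on `D(n, m)`, but every
such endomorphism kills `S(n, m')` if `m < m'`. -/

namespace TemperleyLieb

/-! ### Labellings of diagrams, and the diagrams with a single arc. -/

section DiagramCalculus

variable {n k m : ℕ}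

/-- A pairing contained in a relation with classes of at most two elements is determined by it. -/
theorem Diagram.eq_of_le_ker {L : Type} {x y : Diagram n m} (F : Fin n ⊕ Fin m → L)
    (hx : ∀ p q, x.rel p q → F p = F q) (hy : ∀ p q, y.rel p q → F p = F q)
    (hF : ∀ p q q', F p = F q → F p = F q' → q ≠ p → q' ≠ p → q = q') : x = y := by
  have hp : ∀ p, x.pairing.partner p = y.pairing.partner p := fun p =>
    hF p _ _ (hx _ _ (x.pairing.rel_partner p)) (hy _ _ (y.pairing.rel_partner p))
      (x.pairing.partner_ne p) (y.pairing.partner_ne p)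
  ext p q
  by_cases h : q = p
  · subst h
    exact ⟨fun _ => y.rel.refl _, fun _ => x.rel.refl _⟩
  · constructor
    · intro hpq
      rw [x.pairing.eq_of_rel hpq h, hp]
      exact y.pairing.rel_partner p
    · intro hpq
      rw [y.pairing.eq_of_rel hpq h, ← hp]
      exact x.pairing.rel_partner p

theorem Diagram.eq_of_le {x y : Diagram n m} (h : ∀ p q, x.rel p q → y.rel p q) : x = y :=
  Diagram.eq_of_le_ker (Quotient.mk y.rel) (fun p q hpq => Quotient.sound (h p q hpq))
    (fun _ _ hpq => Quotient.sound hpq) fun p q q' h1 h2 n1 n2 => by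
      rw [y.pairing.eq_of_rel (Quotient.exact h1) n1, y.pairing.eq_of_rel (Quotient.exact h2) n2]

/-- Labellings of the three columns that are constant along the lines of each picture glue to one on
the composite picture. Together with `Diagram.eq_of_le_ker` this reduces identities between
composites of diagrams to arithmetic of labels. -/
theorem Diagram.glue_label {L : Type} {x : Diagram n k} {y : Diagram k m}
    (f : Fin n → L) (g : Fin k → L) (h : Fin m → L)
    (hx : ∀ p q, x.rel p q → Sum.elim f g p = Sum.elim f g q)
    (hy : ∀ p q, y.rel p q → Sum.elim g h p = Sum.elim g h q) (p q)
    (hpq : glue x.rel y.rel p q) : Sum.elim f (Sum.elim g h) p = Sum.elim f (Sum.elim g h) q := by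
  have hle : glue x.rel y.rel ≤ Setoid.ker (Sum.elim f (Sum.elim g h)) := by
    rw [glue, sup_le_iff, map_le_iff, map_le_iff]
    constructor
    · intro p q hpq
      have := hx p q hpq
      rcases p with p | p <;> rcases q with q | q <;> exact this
    · intro p q hpq
      exact hy p q hpq
  exact hle hpq

theorem Diagram.comp_label {L : Type} {x : Diagram n k} {y : Diagram k m}
    (f : Fin n → L) (g : Fin k → L) (h : Fin m → L)
    (hx : ∀ p q, x.rel p q → Sum.elim f g p = Sum.elim f g q)
    (hy : ∀ p q, y.rel p q → Sum.elim g h p = Sum.elim g h q) (p q)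
    (hpq : (x.comp y).rel p q) : Sum.elim f h p = Sum.elim f h q := by
  have := Diagram.glue_label f g h hx hy _ _ hpq
  rcases p with p | p <;> rcases q with q | q <;> exact this

theorem Diagram.glue_left {x : Diagram n k} (y : Diagram k m) {p q : Fin n ⊕ Fin k}
    (h : x.rel p q) : glue x.rel y.rel (Sum.map _root_.id Sum.inl p) (Sum.map _root_.id Sum.inl q) :=
  Setoid.le_def.1 le_sup_left (rel_map _ h)

theorem Diagram.glue_right (x : Diagram n k) {y : Diagram k m} {p q : Fin k ⊕ Fin m}
    (h : y.rel p q) : glue x.rel y.rel (Sum.inr p) (Sum.inr q) :=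
  Setoid.le_def.1 le_sup_right (rel_map _ h)

/-- A closed loop meets the middle column only, so there is none once every middle site is connected
to an outer one. -/
theorem Diagram.loops_eq_zero {x : Diagram n k} {y : Diagram k m}
    (h : ∀ b : Fin k, ∃ o, glue x.rel y.rel (outer o) (Sum.inr (Sum.inl b))) : x.loops y = 0 := by
  have : IsEmpty {c : Quotient (glue x.rel y.rel) // ∀ o, Quotient.mk _ (outer o) ≠ c} := by
    refine ⟨?_⟩
    rintro ⟨c, hc⟩
    induction c using Quotient.inductionOn with
    | _ p =>
      rcases p with a | b | c
      · exact hc (Sum.inl a) rfl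
      · obtain ⟨o, ho⟩ := h b
        exact hc o (Quotient.sound ho)
      · exact hc (Sum.inr c) rfl
  exact Nat.card_of_isEmpty

/-- The order embedding of `ℕ` that omits `i` and `i + 1`. -/
def skip (i j : ℕ) : ℕ := if j < i then j else j + 2

theorem skip_lt {N i j : ℕ} (hj : j < N) : skip i j < N + 2 := by
  unfold skip; split_ifs <;> omega

theorem skip_strictMono (i : ℕ) : StrictMono (skip i) := by
  intro a b hab
  unfold skip; split_ifs <;> omega

theorem skip_ne (i j : ℕ) : skip i j ≠ i ∧ skip i j ≠ i + 1 := by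
  unfold skip; split_ifs <;> omega

theorem exists_skip {N i : ℕ} (hi : i ≤ N) {a : ℕ} (ha : a < N + 2) (h1 : a ≠ i)
    (h2 : a ≠ i + 1) : ∃ j < N, a = skip i j := by
  rcases Nat.lt_or_ge a i with h | h
  · exact ⟨a, by omega, by simp [skip, h]⟩
  · refine ⟨a - 2, by omega, ?_⟩
    unfold skip
    split_ifs <;> omega

/-- The sites of an `(N + 2, N)`-diagram, labelled so that the two ends of each line of the diagram
with the single arc `{i, i + 1}` have the same label. -/
def cupLabel (N i : ℕ) : Fin (N + 2) ⊕ Fin N → ℕ :=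
  Sum.elim (fun a => if (a : ℕ) = i + 1 then i else a) (fun b => skip i b)

theorem cupLabel_pairing {N i : ℕ} (hi : i ≤ N) : IsPairing (Setoid.ker (cupLabel N i)) := by
  rintro (a | b)
  · by_cases h : (a : ℕ) = i ∨ (a : ℕ) = i + 1
    -- The reflection `a ↦ 2 * i + 1 - a` exchanges `i` and `i + 1`.
    · refine ⟨Sum.inl ⟨2 * i + 1 - a, by omega⟩, ⟨?_, ?_⟩, ?_⟩
      · intro e
        have := congrArg Fin.val (Sum.inl_injective e)
        simp only at this
        omega
      · change (if (a : ℕ) = i + 1 then i else a) = if 2 * i + 1 - a = i + 1 then i else 2 * i + 1 - a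
        split_ifs <;> omega
      · rintro (c | c) ⟨h1, h2⟩
        · have h2 : (if (a : ℕ) = i + 1 then i else a) = if (c : ℕ) = i + 1 then i else c := h2
          have h1 : (c : ℕ) ≠ a := fun e => h1 (congrArg Sum.inl (Fin.ext e))
          refine congrArg Sum.inl (Fin.ext ?_)
          change (c : ℕ) = 2 * i + 1 - a
          split_ifs at h2 <;> omega
        · have h2 : (if (a : ℕ) = i + 1 then i else a) = skip i c := h2
          have := skip_ne i c
          split_ifs at h2 <;> omega
    · push Not at h
      obtain ⟨j, hj, e⟩ := exists_skip hi a.2 h.1 h.2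
      refine ⟨Sum.inr ⟨j, hj⟩, ⟨by simp, ?_⟩, ?_⟩
      · change (if (a : ℕ) = i + 1 then i else a) = skip i j
        rw [if_neg h.2, e]
      · rintro (c | c) ⟨h1, h2⟩
        · have h2 : (if (a : ℕ) = i + 1 then i else a) = if (c : ℕ) = i + 1 then i else c := h2
          have h1 : (c : ℕ) ≠ a := fun e => h1 (congrArg Sum.inl (Fin.ext e))
          split_ifs at h2 <;> omega
        · have h2 : (if (a : ℕ) = i + 1 then i else a) = skip i c := h2
          rw [if_neg h.2, e] at h2
          exact congrArg Sum.inr (Fin.ext ((skip_strictMono i).injective h2).symm)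
  · refine ⟨Sum.inl ⟨skip i b, skip_lt b.2⟩, ⟨by simp, ?_⟩, ?_⟩
    · change skip i b = if skip i b = i + 1 then i else skip i b
      rw [if_neg (skip_ne i b).2]
    · rintro (c | c) ⟨h1, h2⟩
      · have h2 : skip i b = if (c : ℕ) = i + 1 then i else c := h2
        refine congrArg Sum.inl (Fin.ext ?_)
        change (c : ℕ) = skip i b
        have := skip_ne i b
        split_ifs at h2 <;> omega
      · have h2 : skip i b = skip i c := h2
        exact absurd (congrArg Sum.inr (Fin.ext ((skip_strictMono i).injective h2).symm)) h1

theorem cupLabel_planar (N i : ℕ) : IsPlanar (Setoid.ker (cupLabel N i)) := by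
  intro a b c d hab hbc hcd hac hbd
  have hac : cupLabel N i a = cupLabel N i c := hac
  have hbd : cupLabel N i b = cupLabel N i d := hbd
  rcases a with a | a <;> rcases b with b | b <;> rcases c with c | c <;> rcases d with d | d <;>
    simp only [bdry, Sum.elim_inl, Sum.elim_inr, cupLabel, skip] at * <;>
    (split_ifs at hac hbd <;> omega)

/-- The `(N + 2, N)`-diagram whose only arc joins the source sites `i` and `i + 1`. -/
def Diagram.cup {N i : ℕ} (hi : i ≤ N) : Diagram (N + 2) N :=
  ⟨Setoid.ker (cupLabel N i), cupLabel_pairing hi, cupLabel_planar N i⟩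

/-- The `(N, N + 2)`-diagram whose only arc joins the target sites `i` and `i + 1`. -/
def Diagram.cap {N i : ℕ} (hi : i ≤ N) : Diagram N (N + 2) := (Diagram.cup hi).flip

theorem Diagram.cup_rel {N i : ℕ} (hi : i ≤ N) (j : Fin N) :
    (Diagram.cup hi).rel (Sum.inl ⟨skip i j, skip_lt j.2⟩) (Sum.inr j) := by
  change (if skip i j = i + 1 then i else skip i j) = skip i j
  rw [if_neg (skip_ne i j).2]

theorem Diagram.cup_rel_arc {N i : ℕ} (hi : i ≤ N) :
    (Diagram.cup hi).rel (Sum.inl ⟨i, by omega⟩) (Sum.inl ⟨i + 1, by omega⟩) := by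
  change (if i = i + 1 then i else i) = if i + 1 = i + 1 then i else i + 1
  simp

/-- To check that a labelling is constant along the lines, it suffices to compare the two ends of
the arc and the two ends of each through line. -/
theorem Diagram.cup_label {L : Type} {N i : ℕ} (hi : i ≤ N) (f : Fin (N + 2) → L) (g : Fin N → L)
    (h1 : f ⟨i, by omega⟩ = f ⟨i + 1, by omega⟩) (h2 : ∀ j : Fin N, f ⟨skip i j, skip_lt j.2⟩ = g j)
    (p q) (hpq : (Diagram.cup hi).rel p q) : Sum.elim f g p = Sum.elim f g q := by
  -- The value of `cupLabel` is itself a source site on the line through `p`, so the label of `p`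
  -- can be read off there.
  have key : ∀ p, Sum.elim f g p = f ⟨cupLabel N i p, by
      rcases p with p | p
      · simp only [cupLabel, Sum.elim_inl]; split_ifs <;> omega
      · exact skip_lt p.2⟩ := by
    rintro (p | p)
    · by_cases h : (p : ℕ) = i + 1
      · have e : p = ⟨i + 1, by omega⟩ := Fin.ext h
        rw [Sum.elim_inl, congrArg f e, ← h1]
        simp [cupLabel, h]
      · simp [cupLabel, h]
    · exact (h2 p).symm
  have hpq : cupLabel N i p = cupLabel N i q := hpq
  rw [key, key]
  congr 2

theorem Diagram.cap_label {L : Type} {N i : ℕ} (hi : i ≤ N) (f : Fin (N + 2) → L) (g : Fin N → L)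
    (h1 : f ⟨i, by omega⟩ = f ⟨i + 1, by omega⟩) (h2 : ∀ j : Fin N, f ⟨skip i j, skip_lt j.2⟩ = g j)
    (p q) (hpq : (Diagram.cap hi).rel p q) : Sum.elim g f p = Sum.elim g f q := by
  have := Diagram.cup_label hi f g h1 h2 _ _ hpq
  rcases p with p | p <;> rcases q with q | q <;> exact this

end DiagramCalculus

/-! ### Removing an arc, and the relations between cups and caps. -/

section DiagramRelations

variable {n k m : ℕ}

theorem Diagram.loops_cup_eq_zero {N i : ℕ} (hi : i ≤ N) (y : Diagram N m) :
    (Diagram.cup hi).loops y = 0 :=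
  Diagram.loops_eq_zero fun b => ⟨Sum.inl _, Diagram.glue_left y (Diagram.cup_rel hi b)⟩

/-- The sites of a diagram other than the source sites `i` and `i + 1`. -/
def skipSite {N : ℕ} (i : ℕ) : Fin N ⊕ Fin m → Fin (N + 2) ⊕ Fin m :=
  Sum.map (fun j => ⟨skip i j, skip_lt j.2⟩) id

/-- Removal of an arc joining the source sites `i` and `i + 1`. -/
def removeRel {N : ℕ} (i : ℕ) (r : Setoid (Fin (N + 2) ⊕ Fin m)) : Setoid (Fin N ⊕ Fin m) :=
  r.comap (skipSite i)

theorem exists_skipSite {N i : ℕ} (hi : i ≤ N) {p : Fin (N + 2) ⊕ Fin m}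
    (h1 : p ≠ Sum.inl ⟨i, by omega⟩) (h2 : p ≠ Sum.inl ⟨i + 1, by omega⟩) :
    ∃ q : Fin N ⊕ Fin m, p = skipSite i q := by
  rcases p with a | c
  · obtain ⟨j, hj, e⟩ := exists_skip hi a.2 (fun e => h1 (congrArg Sum.inl (Fin.ext e)))
      (fun e => h2 (congrArg Sum.inl (Fin.ext e)))
    exact ⟨Sum.inl ⟨j, hj⟩, congrArg Sum.inl (Fin.ext e)⟩
  · exact ⟨Sum.inr c, rfl⟩

theorem skipSite_injective (N i m : ℕ) : Function.Injective
    (skipSite i : Fin N ⊕ Fin m → Fin (N + 2) ⊕ Fin m) :=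
  Function.Injective.sumMap (fun _ _ h =>
    Fin.ext ((skip_strictMono i).injective (congrArg Fin.val h))) Function.injective_id

theorem skipSite_ne {N i : ℕ} (hi : i ≤ N) (q : Fin N ⊕ Fin m) :
    (skipSite i q : Fin (N + 2) ⊕ Fin m) ≠
      Sum.inl ⟨i, by omega⟩ ∧
    (skipSite i q : Fin (N + 2) ⊕ Fin m) ≠
      Sum.inl ⟨i + 1, by omega⟩ := by
  rcases q with j | c
  · exact ⟨fun h => (skip_ne i j).1 (congrArg Fin.val (Sum.inl_injective h)),
      fun h => (skip_ne i j).2 (congrArg Fin.val (Sum.inl_injective h))⟩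
  · simp [skipSite]

/-- The two removed sites are partners of each other, so the partner of a remaining site also
remains. -/
theorem removeRel_pairing {N i : ℕ} (hi : i ≤ N) {r : Setoid (Fin (N + 2) ⊕ Fin m)}
    (hr : IsPairing r) (h : r (Sum.inl ⟨i, by omega⟩) (Sum.inl ⟨i + 1, by omega⟩)) :
    IsPairing (removeRel i r) := by
  intro p
  have hne : (Sum.inl ⟨i + 1, by omega⟩ : Fin (N + 2) ⊕ Fin m) ≠ Sum.inl ⟨i, by omega⟩ := by
    simp
  have e1 := hr.eq_of_rel h hne
  have e2 := hr.eq_of_rel (r.symm h) hne.symm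
  obtain ⟨q, hq⟩ := exists_skipSite hi
    (p := hr.partner (skipSite i p))
    (fun e => (skipSite_ne hi p).2 (by rw [e1, ← e, hr.partner_partner]))
    (fun e => (skipSite_ne hi p).1 (by rw [e2, ← e, hr.partner_partner]))
  refine ⟨q, ⟨?_, ?_⟩, ?_⟩
  · rintro rfl
    exact hr.partner_ne _ hq
  · change r _ _
    rw [← hq]
    exact hr.rel_partner _
  · rintro q' ⟨n1, h1⟩
    apply skipSite_injective N i m
    rw [← hq]
    exact hr.eq_of_rel h1 fun e => n1 (skipSite_injective N i m e)

/-- The remaining sites keep their cyclic position, so planarity survives the removal of an arc. -/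
theorem bdry_skipSite (N i : ℕ) {p q : Fin N ⊕ Fin m} (h : bdry p < bdry q) :
    bdry (skipSite i p : Fin (N + 2) ⊕ Fin m) <
      bdry (skipSite i q : Fin (N + 2) ⊕ Fin m) := by
  rcases p with p | p <;> rcases q with q | q <;>
    simp only [bdry, skip, skipSite, Sum.map_inl, Sum.map_inr, Sum.elim_inl, Sum.elim_inr, id] at * <;>
    (repeat' split_ifs) <;> omega

/-- An arc joining adjacent source sites can be split off. -/
theorem Diagram.exists_eq_cup_comp {N i : ℕ} (hi : i ≤ N) (x : Diagram (N + 2) m)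
    (h : x.rel (Sum.inl ⟨i, by omega⟩) (Sum.inl ⟨i + 1, by omega⟩)) :
    ∃ y : Diagram N m, (Diagram.cup hi).comp y = x := by
  refine ⟨⟨removeRel i x.rel, removeRel_pairing hi x.pairing h, ?_⟩, ?_⟩
  · intro a b c d hab hbc hcd hac
    exact x.planar _ _ _ _ (bdry_skipSite N i hab) (bdry_skipSite N i hbc) (bdry_skipSite N i hcd)
      hac
  -- One inclusion of pairings is enough; the classes of `x` themselves serve as labels.
  · refine Diagram.eq_of_le fun p q hpq => ?_
    have := Diagram.comp_label (L := Quotient x.rel) (fun a => Quotient.mk _ (Sum.inl a))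
      (fun j => Quotient.mk _ (Sum.inl ⟨skip i j, skip_lt j.2⟩))
      (fun c => Quotient.mk _ (Sum.inr c))
      (Diagram.cup_label hi _ _ (Quotient.sound h) fun j => rfl) (fun p q hpq => ?_) p q hpq
    · rcases p with p | p <;> rcases q with q | q <;> exact Quotient.exact this
    · rcases p with p | p <;> rcases q with q | q <;> exact Quotient.sound hpq

/-- Two arcs can be split off in either order; removing the upper arc first lowers the index of the
other by two. -/
theorem Diagram.cup_comp_cup {N i j : ℕ} (hi : i ≤ N) (hj : j ≤ i) :
    (Diagram.cup (show j ≤ N + 2 by omega)).comp (Diagram.cup hi) =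
      (Diagram.cup (show i + 2 ≤ N + 2 by omega)).comp (Diagram.cup (hj.trans hi)) := by
  -- Each line is named by the smallest of its source ends.
  let f : Fin (N + 4) → ℕ := fun a =>
    if (a : ℕ) = j + 1 then j else if (a : ℕ) = i + 3 then i + 2 else a
  let h : Fin N → ℕ := fun c => skip j (skip i c)
  refine Diagram.eq_of_le_ker (Sum.elim f h) (Diagram.comp_label f
    (fun b => if (b : ℕ) = i + 1 then i + 2 else skip j b) h
    (Diagram.cup_label _ _ _ ?_ ?_) (Diagram.cup_label _ _ _ ?_ ?_))
    (Diagram.comp_label f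
    (fun b => if (b : ℕ) = j + 1 then j else skip (i + 2) b) h
    (Diagram.cup_label _ _ _ ?_ ?_) (Diagram.cup_label _ _ _ ?_ ?_)) ?_
  all_goals try first | (intro c; simp only [f, h, skip]; grind) | (simp only [f, skip]; grind)

/-- The arcs occupy disjoint pairs of middle sites, so they slide past each other. Lines that meet
the middle column are named by a middle site. -/
theorem Diagram.cap_comp_cup_of_le {N i j : ℕ} (hi : i ≤ N) (hj : j ≤ i) :
    (Diagram.cap (show j ≤ N + 2 by omega)).comp (Diagram.cup (show i + 2 ≤ N + 2 by omega)) =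
      (Diagram.cup hi).comp (Diagram.cap (hj.trans hi)) := by
  let f : Fin (N + 2) → ℕ := fun a => if (a : ℕ) = i + 1 then i + 2 else skip j a
  let h : Fin (N + 2) → ℕ := fun c => if (c : ℕ) = j + 1 then j else skip (i + 2) c
  refine Diagram.eq_of_le_ker (Sum.elim f h) (Diagram.comp_label f
    (fun a => if (a : ℕ) = j + 1 then j else if (a : ℕ) = i + 3 then i + 2 else a) h
    (Diagram.cap_label _ _ _ ?_ ?_) (Diagram.cup_label _ _ _ ?_ ?_))
    (Diagram.comp_label f (fun b => skip j (skip i b)) h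
    (Diagram.cup_label _ _ _ ?_ ?_) (Diagram.cap_label _ _ _ ?_ ?_)) ?_
  all_goals try first | (intro c; simp only [f, h, skip]; grind) | (simp only [f, h, skip]; grind)
  rintro (p | p) (q | q) (q' | q') <;>
    simp only [f, h, skip, Sum.elim_inl, Sum.elim_inr, ne_eq, Sum.inl.injEq,
      Sum.inr.injEq, Fin.ext_iff, reduceCtorEq] <;> grind

theorem Diagram.glue_of_cup {N i : ℕ} (x : Diagram n (N + 2)) (hi : i ≤ N) (b : Fin (N + 2))
    (h1 : (b : ℕ) ≠ i) (h2 : (b : ℕ) ≠ i + 1) :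
    ∃ o, glue x.rel (Diagram.cup hi).rel (outer (Sum.inr o)) (Sum.inr (Sum.inl b)) := by
  obtain ⟨c, hc, e⟩ := exists_skip hi b.2 h1 h2
  obtain rfl : b = ⟨skip i c, skip_lt hc⟩ := Fin.ext e
  exact ⟨⟨c, hc⟩, Setoid.symm' _ (Diagram.glue_right x (Diagram.cup_rel hi ⟨c, hc⟩))⟩

theorem Diagram.glue_of_cap {N i : ℕ} (hi : i ≤ N) (y : Diagram (N + 2) m) (b : Fin (N + 2))
    (h1 : (b : ℕ) ≠ i) (h2 : (b : ℕ) ≠ i + 1) :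
    ∃ o, glue (Diagram.cap hi).rel y.rel (outer (Sum.inl o)) (Sum.inr (Sum.inl b)) := by
  obtain ⟨c, hc, e⟩ := exists_skip hi b.2 h1 h2
  obtain rfl : b = ⟨skip i c, skip_lt hc⟩ := Fin.ext e
  have h : (Diagram.cap hi).rel (Sum.inl ⟨c, hc⟩) (Sum.inr ⟨skip i c, skip_lt hc⟩) :=
    Setoid.symm' (Diagram.cup hi).rel (Diagram.cup_rel hi ⟨c, hc⟩)
  exact ⟨⟨c, hc⟩, Diagram.glue_left y h⟩

theorem Diagram.glue_cap_arc {N i : ℕ} (hi : i ≤ N) (y : Diagram (N + 2) m) :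
    glue (Diagram.cap hi).rel y.rel (Sum.inr (Sum.inl ⟨i, by omega⟩))
      (Sum.inr (Sum.inl ⟨i + 1, by omega⟩)) := by
  have h : (Diagram.cap hi).rel (Sum.inr ⟨i, by omega⟩) (Sum.inr ⟨i + 1, by omega⟩) :=
    Diagram.cup_rel_arc hi
  exact Diagram.glue_left y h

theorem Diagram.loops_cap_cup_of_le {N i j : ℕ} (hi : i ≤ N) (hj : j ≤ i) :
    (Diagram.cap (show j ≤ N + 2 by omega)).loops (Diagram.cup (show i + 2 ≤ N + 2 by omega)) = 0 := by
  refine Diagram.loops_eq_zero fun b => ?_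
  -- No middle site lies on both arcs, so each one escapes to the left or to the right.
  by_cases hb : (b : ℕ) = j ∨ (b : ℕ) = j + 1
  · obtain ⟨o, ho⟩ := Diagram.glue_of_cup (Diagram.cap (show j ≤ N + 2 by omega))
      (show i + 2 ≤ N + 2 by omega) b (by omega) (by omega)
    exact ⟨_, ho⟩
  · obtain ⟨o, ho⟩ := Diagram.glue_of_cap (show j ≤ N + 2 by omega)
      (Diagram.cup (show i + 2 ≤ N + 2 by omega)) b (by omega) (by omega)
    exact ⟨_, ho⟩

/-- A zigzag straightens: the middle sites `i`, `i + 1`, `i + 2` lie on one line and share the label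
`i`. -/
theorem Diagram.cap_comp_cup_succ {N i : ℕ} (hi : i + 1 ≤ N) :
    (Diagram.cap (show i ≤ N by omega)).comp (Diagram.cup hi) = Diagram.id N := by
  let g : Fin (N + 2) → ℕ := fun b => if (b : ℕ) = i + 1 ∨ (b : ℕ) = i + 2 then i else b
  let f : Fin N → ℕ := fun a => if (a : ℕ) ≤ i then a else a + 2
  refine Diagram.eq_of_le_ker (Sum.elim f f) (Diagram.comp_label f g f
    (Diagram.cap_label _ _ _ ?_ ?_) (Diagram.cup_label _ _ _ ?_ ?_)) ?_ ?_
  all_goals try first | (intro c; simp only [f, g, skip]; grind) | (simp only [f, g]; grind)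
  · intro p q hpq
    have hpq : Sum.elim _root_.id _root_.id p = Sum.elim _root_.id _root_.id q := hpq
    rcases p with p | p <;> rcases q with q | q <;>
      exact congrArg f hpq

theorem Diagram.loops_cap_cup_succ {N i : ℕ} (hi : i + 1 ≤ N) :
    (Diagram.cap (show i ≤ N by omega)).loops (Diagram.cup hi) = 0 := by
  refine Diagram.loops_eq_zero fun b => ?_
  by_cases hb : (b : ℕ) = i
  · obtain ⟨o, ho⟩ := Diagram.glue_of_cup (Diagram.cap (show i ≤ N by omega)) hi b (by omega)
      (by omega)
    exact ⟨_, ho⟩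
  -- The site `i + 1` lies on both arcs; it is connected to `i`, which lies off the arc of the cup.
  by_cases hb' : (b : ℕ) = i + 1
  · obtain ⟨o, ho⟩ := Diagram.glue_of_cup (Diagram.cap (show i ≤ N by omega)) hi
      ⟨i, by omega⟩ (by simp) (by simp only; omega)
    rw [show b = ⟨i + 1, by omega⟩ from Fin.ext hb']
    exact ⟨_, Setoid.trans' _ ho (Diagram.glue_cap_arc _ _)⟩
  · obtain ⟨o, ho⟩ := Diagram.glue_of_cap (show i ≤ N by omega) (Diagram.cup hi) b hb hb'
    exact ⟨_, ho⟩

theorem Diagram.cap_comp_cup {N i : ℕ} (hi : i ≤ N) :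
    (Diagram.cap hi).comp (Diagram.cup hi) = Diagram.id N := by
  let g : Fin (N + 2) → ℕ := fun b => if (b : ℕ) = i + 1 then i else b
  let f : Fin N → ℕ := fun a => skip i a
  refine Diagram.eq_of_le_ker (Sum.elim f f) (Diagram.comp_label f g f
    (Diagram.cap_label _ _ _ ?_ ?_) (Diagram.cup_label _ _ _ ?_ ?_)) ?_ ?_
  all_goals try first | (intro c; simp only [f, g, skip]; grind) | (simp only [f, g, skip]; grind)
  · intro p q hpq
    have hpq : Sum.elim _root_.id _root_.id p = Sum.elim _root_.id _root_.id q := hpq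
    rcases p with p | p <;> rcases q with q | q <;>
      exact congrArg f hpq

/-- The only loop is the circle through the middle sites `i` and `i + 1`: their indicator labelling
separates it from the outer sites, and every other middle site is connected to an outer one. -/
theorem Diagram.loops_cap_cup {N i : ℕ} (hi : i ≤ N) :
    (Diagram.cap hi).loops (Diagram.cup hi) = 1 := by
  let Z := glue (Diagram.cap hi).rel (Diagram.cup hi).rel
  let c₀ : Quotient Z := Quotient.mk _ (Sum.inr (Sum.inl ⟨i, by omega⟩))
  have h0 : ∀ o, Quotient.mk Z (outer o) ≠ c₀ := by
    intro o ho
    have := Diagram.glue_label (fun a : Fin N => False)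
      (fun b : Fin (N + 2) => (b : ℕ) = i ∨ (b : ℕ) = i + 1) (fun a : Fin N => False)
      (Diagram.cap_label hi _ _ (by simp) fun j => by simp [skip_ne])
      (Diagram.cup_label hi _ _ (by simp) fun j => by simp [skip_ne]) _ _ (Quotient.exact ho)
    rcases o with o | o <;> simp [outer] at this
  have h1 : ∀ c : {c : Quotient Z // ∀ o, Quotient.mk Z (outer o) ≠ c}, c = ⟨c₀, h0⟩ := by
    rintro ⟨c, hc⟩
    apply Subtype.ext
    change c = c₀
    induction c using Quotient.inductionOn with
    | _ p =>
      rcases p with a | b | a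
      · exact absurd rfl (hc (Sum.inl a))
      · by_cases hb : (b : ℕ) = i
        · rw [show b = ⟨i, by omega⟩ from Fin.ext hb]
        by_cases hb' : (b : ℕ) = i + 1
        · rw [show b = ⟨i + 1, by omega⟩ from Fin.ext hb']
          exact (Quotient.sound (Diagram.glue_cap_arc hi _)).symm
        · obtain ⟨o, ho⟩ := Diagram.glue_of_cap hi (Diagram.cup hi) b hb hb'
          exact absurd (Quotient.sound ho) (hc _)
      · exact absurd rfl (hc (Sum.inr a))
  have : Unique {c : Quotient Z // ∀ o, Quotient.mk Z (outer o) ≠ c} := ⟨⟨⟨c₀, h0⟩⟩, h1⟩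
  exact Nat.card_unique

end DiagramRelations

/-! ### Innermost arcs. -/

section Adjacent

variable {n m : ℕ}

/-- Below an arc joining source sites there is an arc joining adjacent source sites. -/
theorem Diagram.exists_adjacent (x : Diagram n m) (a b : Fin n) (hab : a < b)
    (h : x.rel (Sum.inl a) (Sum.inl b)) :
    ∃ (i : ℕ) (hi : i + 1 < n), x.rel (Sum.inl ⟨i, by omega⟩) (Sum.inl ⟨i + 1, hi⟩) := by
  induction d : (b : ℕ) - a using Nat.strong_induction_on generalizing a b with
  | _ d ih =>
    have hab' : (a : ℕ) < b := hab
    by_cases hb : (b : ℕ) = a + 1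
    · rw [show b = ⟨a + 1, by omega⟩ from Fin.ext hb] at h
      exact ⟨a, _, h⟩
    let a' : Fin n := ⟨a + 1, by omega⟩
    have hp := x.pairing.rel_partner (Sum.inl a')
    have hn := x.pairing.partner_ne (Sum.inl a')
    set p := x.pairing.partner (Sum.inl a') with hpdef
    have ea : x.pairing.partner (Sum.inl a) = Sum.inl b :=
      (x.pairing.eq_of_rel h (fun e => hab.ne' (Sum.inl_injective e))).symm
    have na : p ≠ Sum.inl a := by
      intro e
      have := x.pairing.partner_partner (Sum.inl a')
      rw [← hpdef, e, ea] at this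
      have := congrArg Fin.val (Sum.inl_injective this)
      simp only [a'] at this
      omega
    have nb : p ≠ Sum.inl b := by
      intro e
      have h1 := x.pairing.partner_partner (Sum.inl a')
      have h2 := x.pairing.partner_partner (Sum.inl a)
      rw [ea] at h2
      rw [← hpdef, e, h2] at h1
      have := congrArg Fin.val (Sum.inl_injective h1)
      simp only [a'] at this
      omega
    have ha1 : bdry p ≠ bdry (Sum.inl a : Fin n ⊕ Fin m) := fun e => na (bdry_injective e)
    have hb1 : bdry p ≠ bdry (Sum.inl b : Fin n ⊕ Fin m) := fun e => nb (bdry_injective e)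
    have hn1 : bdry p ≠ bdry (Sum.inl a' : Fin n ⊕ Fin m) := fun e => hn (bdry_injective e)
    have e1 : bdry (Sum.inl a' : Fin n ⊕ Fin m) = a + 1 := rfl
    have e2 : bdry (Sum.inl a : Fin n ⊕ Fin m) = a := rfl
    have e3 : bdry (Sum.inl b : Fin n ⊕ Fin m) = b := rfl
    -- By planarity the partner of `a + 1` is trapped between `a` and `b`, so its arc is shorter and
    -- the induction applies.
    have h1 : ¬ bdry p < a := fun hlt =>
      x.planar p (Sum.inl a) (Sum.inl a') (Sum.inl b) (by omega) (by omega) (by omega)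
        (x.rel.symm hp) h
    have h2 : ¬ b < bdry p := fun hlt =>
      x.planar (Sum.inl a) (Sum.inl a') (Sum.inl b) p (by omega) (by omega) (by omega) h hp
    rcases hpe : p with c | c
    · rw [hpe] at hp h1 h2 ha1 hb1 hn1
      have e4 : bdry (Sum.inl c : Fin n ⊕ Fin m) = c := rfl
      refine ih ((c : ℕ) - a') ?_ a' c ?_ hp rfl
      · simp only [a']; omega
      · change (a : ℕ) + 1 < c
        omega
    · rw [hpe] at h2
      have e4 : bdry (Sum.inr c : Fin n ⊕ Fin m) = n + m - 1 - c := rfl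
      omega

/-- If no line returns to its own column, the lines give a bijection of the two columns. Planarity
makes it increasing, so it is the identity. -/
theorem Diagram.adjacent_or_id (x : Diagram n m) :
    (∃ (i : ℕ) (hi : i + 1 < n), x.rel (Sum.inl ⟨i, by omega⟩) (Sum.inl ⟨i + 1, hi⟩)) ∨
    (∃ (i : ℕ) (hi : i + 1 < m), x.rel (Sum.inr ⟨i, by omega⟩) (Sum.inr ⟨i + 1, hi⟩)) ∨
    ∃ e : n = m, e ▸ x = Diagram.id m := by
  by_cases hl : ∃ a b : Fin n, a ≠ b ∧ x.rel (Sum.inl a) (Sum.inl b)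
  · obtain ⟨a, b, hab, h⟩ := hl
    rcases lt_or_gt_of_ne hab with hlt | hlt
    · exact Or.inl (x.exists_adjacent a b hlt h)
    · exact Or.inl (x.exists_adjacent b a hlt (x.rel.symm h))
  by_cases hr : ∃ a b : Fin m, a ≠ b ∧ x.rel (Sum.inr a) (Sum.inr b)
  · obtain ⟨a, b, hab, h⟩ := hr
    rcases lt_or_gt_of_ne hab with hlt | hlt
    · exact Or.inr (Or.inl (x.flip.exists_adjacent a b hlt h))
    · exact Or.inr (Or.inl (x.flip.exists_adjacent b a hlt (x.rel.symm h)))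
  refine Or.inr (Or.inr ?_)
  have hg : ∀ a : Fin n, ∃ c : Fin m, x.rel (Sum.inl a) (Sum.inr c) := by
    intro a
    have h1 := x.pairing.rel_partner (Sum.inl a)
    have h2 := x.pairing.partner_ne (Sum.inl a)
    rcases e : x.pairing.partner (Sum.inl a) with b | c
    · rw [e] at h1 h2
      exact absurd ⟨a, b, fun e => h2 (congrArg Sum.inl e.symm), h1⟩ hl
    · exact ⟨c, e ▸ h1⟩
  have hg' : ∀ c : Fin m, ∃ a : Fin n, x.rel (Sum.inl a) (Sum.inr c) := by
    intro c
    have h1 := x.pairing.rel_partner (Sum.inr c)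
    have h2 := x.pairing.partner_ne (Sum.inr c)
    rcases e : x.pairing.partner (Sum.inr c) with a | b
    · rw [e] at h1
      exact ⟨a, x.rel.symm h1⟩
    · rw [e] at h1 h2
      exact absurd ⟨c, b, fun e => h2 (congrArg Sum.inr e.symm), h1⟩ hr
  choose g hg using hg
  have hmono : StrictMono g := by
    intro a a' haa
    by_contra hc
    have hne : g a ≠ g a' := by
      intro e
      refine hl ⟨a, a', haa.ne, x.rel.trans (hg a) ?_⟩
      rw [e]
      exact x.rel.symm (hg a')
    have hlt : (g a' : ℕ) < g a := lt_of_le_of_ne (not_lt.1 hc) fun e => hne (Fin.ext e.symm)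
    have haa : (a : ℕ) < a' := haa
    refine x.planar (Sum.inl a) (Sum.inl a') (Sum.inr (g a)) (Sum.inr (g a')) ?_ ?_ ?_
      (hg a) (hg a') <;> simp only [bdry, Sum.elim_inl, Sum.elim_inr] <;> omega
  have hsurj : Function.Surjective g := by
    intro c
    obtain ⟨a, ha⟩ := hg' c
    refine ⟨a, ?_⟩
    by_contra hne
    exact hr ⟨g a, c, hne, x.rel.trans (x.rel.symm (hg a)) ha⟩
  have hcard := Fintype.card_of_bijective ⟨hmono.injective, hsurj⟩
  simp only [Fintype.card_fin] at hcard
  subst hcard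
  refine ⟨rfl, ?_⟩
  have hid : g = _root_.id := (StrictMono.range_inj hmono strictMono_id).1
    (by rw [hsurj.range_eq, Set.range_id])
  symm
  refine Diagram.eq_of_le fun p q hpq => ?_
  have hpq : Sum.elim _root_.id _root_.id p = Sum.elim _root_.id _root_.id q := hpq
  rw [hid] at hg
  rcases p with p | p <;> rcases q with q | q <;>
    (have hpq : p = q := hpq) <;> subst hpq
  · exact x.rel.refl _
  · exact hg p
  · exact x.rel.symm (hg p)
  · exact x.rel.refl _

end Adjacent

/-! ### Cups, caps and the generators as morphisms. -/

section HomRelations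

variable {R : Type*} [CommRing R] (δ : R) {n k m : ℕ}

/-- The morphism given by a single arc joining the source sites `i` and `i + 1`. -/
noncomputable def Hom.cup {N i : ℕ} (hi : i ≤ N) : Hom δ (N + 2) N := Hom.of δ (Diagram.cup hi)

/-- The morphism given by a single arc joining the target sites `i` and `i + 1`. -/
noncomputable def Hom.cap {N i : ℕ} (hi : i ≤ N) : Hom δ N (N + 2) := Hom.of δ (Diagram.cap hi)

theorem Hom.flip_cup {N i : ℕ} (hi : i ≤ N) : Hom.flip δ (Hom.cup δ hi) = Hom.cap δ hi :=
  Hom.flip_of δ _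

theorem Hom.flip_cap {N i : ℕ} (hi : i ≤ N) : Hom.flip δ (Hom.cap δ hi) = Hom.cup δ hi := by
  rw [← Hom.flip_cup, Hom.flip_flip]

theorem Hom.comp_of_eq {x : Diagram n k} {y : Diagram k m} {z : Diagram n m} (h : x.loops y = 0)
    (hz : x.comp y = z) : Hom.comp δ (Hom.of δ x) (Hom.of δ y) = Hom.of δ z := by
  rw [Hom.comp_of, h, pow_zero, one_smul, hz]

theorem Hom.cup_comp_of {N i : ℕ} (hi : i ≤ N) (y : Diagram N m) :
    Hom.comp δ (Hom.cup δ hi) (Hom.of δ y) = Hom.of δ ((Diagram.cup hi).comp y) :=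
  Hom.comp_of_eq δ (Diagram.loops_cup_eq_zero hi y) rfl

theorem Hom.cup_comp_cup {N i j : ℕ} (hi : i ≤ N) (hj : j ≤ i) :
    Hom.comp δ (Hom.cup δ (show j ≤ N + 2 by omega)) (Hom.cup δ hi) =
      Hom.comp δ (Hom.cup δ (show i + 2 ≤ N + 2 by omega)) (Hom.cup δ (hj.trans hi)) := by
  unfold Hom.cup
  rw [Hom.comp_of_eq δ (Diagram.loops_cup_eq_zero _ _) (Diagram.cup_comp_cup hi hj),
    Hom.comp_of_eq δ (Diagram.loops_cup_eq_zero _ _) rfl]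

theorem Hom.cap_comp_cup_of_le {N i j : ℕ} (hi : i ≤ N) (hj : j ≤ i) :
    Hom.comp δ (Hom.cap δ (show j ≤ N + 2 by omega)) (Hom.cup δ (show i + 2 ≤ N + 2 by omega)) =
      Hom.comp δ (Hom.cup δ hi) (Hom.cap δ (hj.trans hi)) := by
  unfold Hom.cup Hom.cap
  rw [Hom.comp_of_eq δ (Diagram.loops_cap_cup_of_le hi hj) (Diagram.cap_comp_cup_of_le hi hj),
    Hom.comp_of_eq δ (Diagram.loops_cup_eq_zero _ _) rfl]

theorem Hom.cap_comp_cup_of_ge {N i j : ℕ} (hi : i ≤ N) (hj : j ≤ i) :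
    Hom.comp δ (Hom.cap δ (show i + 2 ≤ N + 2 by omega)) (Hom.cup δ (show j ≤ N + 2 by omega)) =
      Hom.comp δ (Hom.cup δ (hj.trans hi)) (Hom.cap δ hi) := by
  have h := congrArg (Hom.flip δ) (Hom.cap_comp_cup_of_le δ hi hj)
  simpa only [Hom.flip_comp, Hom.flip_cup, Hom.flip_cap] using h

theorem Hom.cap_comp_cup_succ {N i : ℕ} (hi : i + 1 ≤ N) :
    Hom.comp δ (Hom.cap δ (show i ≤ N by omega)) (Hom.cup δ hi) = Hom.of δ (Diagram.id N) :=
  Hom.comp_of_eq δ (Diagram.loops_cap_cup_succ hi) (Diagram.cap_comp_cup_succ hi)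

theorem Hom.cap_succ_comp_cup {N i : ℕ} (hi : i + 1 ≤ N) :
    Hom.comp δ (Hom.cap δ hi) (Hom.cup δ (show i ≤ N by omega)) = Hom.of δ (Diagram.id N) := by
  have h := congrArg (Hom.flip δ) (Hom.cap_comp_cup_succ δ hi)
  simpa only [Hom.flip_comp, Hom.flip_cup, Hom.flip_cap, Hom.flip_of, Diagram.flip_id] using h

theorem Hom.cap_comp_cup {N i : ℕ} (hi : i ≤ N) :
    Hom.comp δ (Hom.cap δ hi) (Hom.cup δ hi) = δ • Hom.of δ (Diagram.id N) := by
  unfold Hom.cup Hom.cap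
  rw [Hom.comp_of, Diagram.loops_cap_cup, pow_one, Diagram.cap_comp_cup]

/-- The generator `e_i` of `TL_n`, for `i + 2 ≤ n`. -/
noncomputable def gen : (n i : ℕ) → Hom δ n n
  | 0, _ => 0
  | 1, _ => 0
  | N + 2, i => if hi : i ≤ N then Hom.comp δ (Hom.cup δ hi) (Hom.cap δ hi) else 0

theorem gen_eq {N i : ℕ} (hi : i ≤ N) :
    gen δ (N + 2) i = Hom.comp δ (Hom.cup δ hi) (Hom.cap δ hi) := dif_pos hi

theorem flip_gen (n i : ℕ) : Hom.flip δ (gen δ n i) = gen δ n i := by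
  match n with
  | 0 => exact map_zero _
  | 1 => exact map_zero _
  | N + 2 =>
    by_cases hi : i ≤ N
    · rw [gen_eq δ hi, Hom.flip_comp, Hom.flip_cap, Hom.flip_cup]
    · rw [gen, dif_neg hi, map_zero]

theorem gen_comp_cup {N i : ℕ} (hi : i ≤ N) :
    Hom.comp δ (gen δ (N + 2) i) (Hom.cup δ hi) = δ • Hom.cup δ hi := by
  rw [gen_eq δ hi, Hom.comp_assoc, Hom.cap_comp_cup, map_smul, Hom.comp_id]

theorem gen_comp_cup_succ {N i : ℕ} (hi : i + 1 ≤ N) :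
    Hom.comp δ (gen δ (N + 2) i) (Hom.cup δ hi) = Hom.cup δ (show i ≤ N by omega) := by
  rw [gen_eq δ (show i ≤ N by omega), Hom.comp_assoc, Hom.cap_comp_cup_succ, Hom.comp_id]

theorem gen_succ_comp_cup {N i : ℕ} (hi : i + 1 ≤ N) :
    Hom.comp δ (gen δ (N + 2) (i + 1)) (Hom.cup δ (show i ≤ N by omega)) = Hom.cup δ hi := by
  rw [gen_eq δ hi, Hom.comp_assoc, Hom.cap_succ_comp_cup, Hom.comp_id]

/-- A generator whose sites lie above the arc commutes past it with unchanged index; for one below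
the arc (`gen_comp_cup_of_ge`) the index drops by two. -/
theorem gen_comp_cup_of_le {N i j : ℕ} (hi : i ≤ N) (hj : j + 2 ≤ i) :
    Hom.comp δ (gen δ (N + 2) j) (Hom.cup δ hi) = Hom.comp δ (Hom.cup δ hi) (gen δ N j) := by
  obtain ⟨i, rfl⟩ : ∃ i', i = i' + 2 := ⟨i - 2, by omega⟩
  obtain ⟨N, rfl⟩ : ∃ N', N = N' + 2 := ⟨N - 2, by omega⟩
  rw [gen_eq δ (show j ≤ N + 2 by omega), gen_eq δ (show j ≤ N by omega), Hom.comp_assoc,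
    Hom.cap_comp_cup_of_le δ (show i ≤ N by omega) (show j ≤ i by omega), ← Hom.comp_assoc,
    Hom.cup_comp_cup, Hom.comp_assoc]
  omega

theorem gen_comp_cup_of_ge {N i j : ℕ} (hij : i ≤ j) (hj : j + 2 ≤ N) :
    Hom.comp δ (gen δ (N + 2) (j + 2)) (Hom.cup δ (show i ≤ N by omega)) =
      Hom.comp δ (Hom.cup δ (show i ≤ N by omega)) (gen δ N j) := by
  obtain ⟨N, rfl⟩ : ∃ N', N = N' + 2 := ⟨N - 2, by omega⟩
  rw [gen_eq δ (show j + 2 ≤ N + 2 by omega), gen_eq δ (show j ≤ N by omega), Hom.comp_assoc,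
    Hom.cap_comp_cup_of_ge δ (show j ≤ N by omega) hij, ← Hom.comp_assoc,
    ← Hom.cup_comp_cup δ (show j ≤ N by omega) hij, Hom.comp_assoc]

end HomRelations

/-! ### Jucys–Murphy elements and how they pass through a cup. -/

section JucysMurphy

variable {R : Type*} [CommRing R] (δ q : R)

/-- A crossing of the strands `i` and `i + 1`. -/
noncomputable def braid (n i : ℕ) : Hom δ n n := q • Hom.of δ (Diagram.id n) - gen δ n i

/-- The Jucys--Murphy elements of `TL_n`. -/
noncomputable def jucysMurphy (n : ℕ) : ℕ → Hom δ n n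
  | 0 => Hom.of δ (Diagram.id n)
  | k + 1 => Hom.comp δ (braid δ q n k) (Hom.comp δ (jucysMurphy n k) (braid δ q n k))

theorem jucysMurphy_succ (n k : ℕ) : jucysMurphy δ q n (k + 1) =
    Hom.comp δ (braid δ q n k) (Hom.comp δ (jucysMurphy δ q n k) (braid δ q n k)) := rfl

theorem braid_comp {n m : ℕ} (i : ℕ) (f : Hom δ n m) :
    Hom.comp δ (braid δ q n i) f = q • f - Hom.comp δ (gen δ n i) f := by
  rw [braid, map_sub, map_smul, LinearMap.sub_apply, LinearMap.smul_apply, Hom.id_comp]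

theorem comp_braid {n m : ℕ} (i : ℕ) (f : Hom δ m n) :
    Hom.comp δ f (braid δ q n i) = q • f - Hom.comp δ f (gen δ n i) := by
  rw [braid, map_sub, map_smul, Hom.comp_id]

theorem flip_braid (n i : ℕ) : Hom.flip δ (braid δ q n i) = braid δ q n i := by
  rw [braid, map_sub, map_smul, flip_gen, Hom.flip_of, Diagram.flip_id]

/-- These elements are palindromes in flip-invariant crossings, so each relation with a cup also
yields one with a cap. -/
theorem flip_jucysMurphy (n k : ℕ) :
    Hom.flip δ (jucysMurphy δ q n k) = jucysMurphy δ q n k := by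
  induction k with
  | zero => rw [jucysMurphy, Hom.flip_of, Diagram.flip_id]
  | succ k ih => rw [jucysMurphy, Hom.flip_comp, Hom.flip_comp, ih, flip_braid, Hom.comp_assoc]

/-- For `k < i` only crossings that stay above the arc are involved, and each of them commutes past
it. -/
theorem jucysMurphy_comp_cup_of_lt {N i k : ℕ} (hi : i ≤ N) (hk : k < i ∨ k = 0) :
    Hom.comp δ (jucysMurphy δ q (N + 2) k) (Hom.cup δ hi) =
      Hom.comp δ (Hom.cup δ hi) (jucysMurphy δ q N k) := by
  induction k with
  | zero => rw [jucysMurphy, jucysMurphy, Hom.id_comp, Hom.comp_id]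
  | succ k ih =>
    have hT : Hom.comp δ (braid δ q (N + 2) k) (Hom.cup δ hi) =
        Hom.comp δ (Hom.cup δ hi) (braid δ q N k) := by
      rw [braid_comp, comp_braid, gen_comp_cup_of_le δ hi (by omega)]
    rw [jucysMurphy, jucysMurphy, Hom.comp_assoc, Hom.comp_assoc, hT,
      ← Hom.comp_assoc δ (jucysMurphy δ q (N + 2) k), ih (by omega), Hom.comp_assoc,
      ← Hom.comp_assoc δ (braid δ q (N + 2) k), hT, Hom.comp_assoc]

theorem cap_comp_jucysMurphy_of_lt {N i k : ℕ} (hi : i ≤ N) (hk : k < i ∨ k = 0) :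
    Hom.comp δ (Hom.cap δ hi) (jucysMurphy δ q (N + 2) k) =
      Hom.comp δ (jucysMurphy δ q N k) (Hom.cap δ hi) := by
  have h := congrArg (Hom.flip δ) (jucysMurphy_comp_cup_of_lt δ q hi hk)
  simpa only [Hom.flip_comp, flip_jucysMurphy, Hom.flip_cup] using h

variable {δ q} {r : R} (hqr : q * r = 1) (hδ : δ = q + r)

include hqr hδ

/-- Dragging a strand across an arc moves the arc by one place. The terms in the original cup cancel
because `q * δ = q ^ 2 + 1`, which leaves the factor `-q`. -/
theorem braid_comp_braid_comp_cup {N i : ℕ} (hi : i + 1 ≤ N) :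
    Hom.comp δ (braid δ q (N + 2) i) (Hom.comp δ (braid δ q (N + 2) (i + 1))
      (Hom.cup δ (show i ≤ N by omega))) = -q • Hom.cup δ hi := by
  rw [braid_comp δ q (i + 1), gen_succ_comp_cup δ hi, braid_comp, map_sub, map_smul,
    gen_comp_cup, gen_comp_cup_succ]
  have h : q * δ = q * q + 1 := by rw [hδ, mul_add, hqr]
  rw [smul_sub, smul_smul, smul_smul, h, add_smul]
  module

theorem braid_succ_comp_braid_comp_cup {N i : ℕ} (hi : i + 1 ≤ N) :
    Hom.comp δ (braid δ q (N + 2) (i + 1)) (Hom.comp δ (braid δ q (N + 2) i)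
      (Hom.cup δ hi)) = -q • Hom.cup δ (show i ≤ N by omega) := by
  rw [braid_comp δ q i, gen_comp_cup_succ δ hi, braid_comp, map_sub, map_smul,
    gen_comp_cup, gen_succ_comp_cup δ hi]
  have h : q * δ = q * q + 1 := by rw [hδ, mul_add, hqr]
  rw [smul_sub, smul_smul, smul_smul, h, add_smul]
  module

/-- For `k = i` the inner two crossings move the arc from `i` to `i + 1`, where it commutes with the
element of index `i`, and the outer two move it back; the factor is `(-q) ^ 2`. Later crossings lie
below the arc and are merely reindexed. -/
theorem jucysMurphy_comp_cup_of_ge {N i k : ℕ} (hik : i ≤ k) (hk : k < N) :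
    Hom.comp δ (jucysMurphy δ q (N + 2) (k + 2)) (Hom.cup δ (show i ≤ N by omega)) =
      q ^ 2 • Hom.comp δ (Hom.cup δ (show i ≤ N by omega)) (jucysMurphy δ q N k) := by
  induction k, hik using Nat.le_induction with
  | base =>
    rw [jucysMurphy, jucysMurphy]
    simp only [Hom.comp_assoc]
    rw [braid_comp_braid_comp_cup hqr hδ hk, map_smul, jucysMurphy_comp_cup_of_lt δ q hk (by omega),
      map_smul, map_smul, ← Hom.comp_assoc, ← Hom.comp_assoc, Hom.comp_assoc δ (braid _ _ _ _),
      braid_succ_comp_braid_comp_cup hqr hδ hk, map_smul, LinearMap.smul_apply, smul_smul]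
    congr 1
    ring
  | succ k hik ih =>
    have hT : Hom.comp δ (braid δ q (N + 2) (k + 2)) (Hom.cup δ (show i ≤ N by omega)) =
        Hom.comp δ (Hom.cup δ (show i ≤ N by omega)) (braid δ q N k) := by
      rw [braid_comp, comp_braid, gen_comp_cup_of_ge δ hik (by omega)]
    rw [jucysMurphy_succ δ q (N + 2) (k + 2), jucysMurphy_succ δ q N k, Hom.comp_assoc,
      Hom.comp_assoc, hT, ← Hom.comp_assoc δ (jucysMurphy δ q (N + 2) (k + 2)), ih (by omega), map_smul,
      LinearMap.smul_apply, Hom.comp_assoc, map_smul,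
      ← Hom.comp_assoc δ (braid δ q (N + 2) (k + 2)), hT, Hom.comp_assoc]

/-- This evaluates a partial trace of the Jucys–Murphy element, closing up its last strand.
Expanding the two outer crossings expresses it by the preceding one, and each step contributes one
new summand to the right-hand side. -/
theorem gen_comp_jucysMurphy_comp_cup {N i : ℕ} (hi : i ≤ N) :
    Hom.comp δ (gen δ (N + 2) i) (Hom.comp δ (jucysMurphy δ q (N + 2) i) (Hom.cup δ hi)) =
      (q ^ 3 - q) • Hom.comp δ (Hom.cup δ hi) (∑ k ∈ Finset.range i, jucysMurphy δ q N k) +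
        δ • Hom.cup δ hi := by
  induction i with
  | zero => rw [jucysMurphy, Hom.id_comp, gen_comp_cup]; simp
  | succ i ih =>
    have hi' : i ≤ N := by omega
    set L := jucysMurphy δ q N i with hL
    have h1 : Hom.comp δ (jucysMurphy δ q (N + 2) i) (Hom.cup δ hi) =
        Hom.comp δ (Hom.cup δ hi) L := jucysMurphy_comp_cup_of_lt δ q hi (by omega)
    have h2 : Hom.comp δ (gen δ (N + 2) (i + 1)) (Hom.comp δ (Hom.cup δ hi) L) =
        δ • Hom.comp δ (Hom.cup δ hi) L := by
      rw [← Hom.comp_assoc, gen_comp_cup, map_smul, LinearMap.smul_apply]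
    have h3 : Hom.comp δ (gen δ (N + 2) (i + 1)) (Hom.comp δ (gen δ (N + 2) i)
        (Hom.comp δ (Hom.cup δ hi) L)) = Hom.comp δ (Hom.cup δ hi) L := by
      rw [← Hom.comp_assoc δ (gen δ (N + 2) i), gen_comp_cup_succ, ← Hom.comp_assoc,
        gen_succ_comp_cup]
    have h4 : Hom.comp δ (gen δ (N + 2) (i + 1)) (Hom.comp δ (jucysMurphy δ q (N + 2) i)
        (Hom.cup δ hi')) = Hom.comp δ (Hom.cup δ hi) L := by
      rw [gen_eq δ hi, Hom.comp_assoc, ← Hom.comp_assoc δ (Hom.cap δ hi),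
        cap_comp_jucysMurphy_of_lt δ q hi (by omega), Hom.comp_assoc, Hom.cap_succ_comp_cup,
        Hom.comp_id]
    have h5 := congrArg (Hom.comp δ (gen δ (N + 2) (i + 1))) (ih hi')
    rw [map_add, map_smul, map_smul, ← Hom.comp_assoc δ _ (Hom.cup δ hi'),
      gen_succ_comp_cup δ hi] at h5
    rw [jucysMurphy, Hom.comp_assoc, Hom.comp_assoc, braid_comp δ q i (Hom.cup δ hi),
      gen_comp_cup_succ δ hi, map_sub, map_smul, h1, braid_comp]
    simp only [map_sub, map_smul, h2, h3, h4, h5, Finset.sum_range_succ, map_add]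
    rw [← hL]
    -- The new summand collects `q ^ 2 * δ` from the product of the identity terms of the crossings
    -- and `-q` from each of the two mixed terms, hence `q ^ 3 - q`.
    have h : q * q * δ = q ^ 3 + q := by
      rw [hδ]
      linear_combination q * hqr
    have e : (q * q * δ - q - q) • Hom.comp δ (Hom.cup δ hi) L =
        (q ^ 3 - q) • Hom.comp δ (Hom.cup δ hi) L := by
      congr 1
      linear_combination h
    rw [smul_add, ← e]
    module

/-- The terms with index below `i` pass unchanged and those from `i + 2` on acquire `q ^ 2`. The
terms `i` and `i + 1` together reduce to a partial trace, which supplies the missing `q ^ 2 - 1` for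
the lower indices and the constant `1 + r ^ 2`. -/
theorem sum_jucysMurphy_comp_cup {N i : ℕ} (hi : i ≤ N) :
    Hom.comp δ (∑ k ∈ Finset.range (N + 2), jucysMurphy δ q (N + 2) k) (Hom.cup δ hi) =
      q ^ 2 • Hom.comp δ (Hom.cup δ hi) (∑ k ∈ Finset.range N, jucysMurphy δ q N k) +
        (1 + r ^ 2) • Hom.cup δ hi := by
  have h1 : Hom.comp δ (∑ k ∈ Finset.range i, jucysMurphy δ q (N + 2) k) (Hom.cup δ hi) =
      Hom.comp δ (Hom.cup δ hi) (∑ k ∈ Finset.range i, jucysMurphy δ q N k) := by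
    rw [map_sum, map_sum, LinearMap.sum_apply]
    exact Finset.sum_congr rfl fun k hk =>
      jucysMurphy_comp_cup_of_lt δ q hi (Or.inl (Finset.mem_range.1 hk))
  -- The cup is an eigenvector of its own crossing, with eigenvalue `q - δ = -r`.
  have h2 : Hom.comp δ (jucysMurphy δ q (N + 2) (i + 1)) (Hom.cup δ hi) =
      -Hom.comp δ (jucysMurphy δ q (N + 2) i) (Hom.cup δ hi) +
        r • Hom.comp δ (gen δ (N + 2) i) (Hom.comp δ (jucysMurphy δ q (N + 2) i)
          (Hom.cup δ hi)) := by
    rw [jucysMurphy, Hom.comp_assoc, Hom.comp_assoc, braid_comp δ q i (Hom.cup δ hi),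
      gen_comp_cup, ← sub_smul, map_smul, map_smul, braid_comp, smul_sub, smul_smul,
      show (q - δ) * q = -1 by rw [hδ]; linear_combination -hqr, show q - δ = -r by rw [hδ]; ring]
    module
  have h3 : Hom.comp δ (∑ k ∈ Finset.range (N - i), jucysMurphy δ q (N + 2) (i + 2 + k))
      (Hom.cup δ hi) = q ^ 2 • Hom.comp δ (Hom.cup δ hi)
        (∑ k ∈ Finset.range (N - i), jucysMurphy δ q N (i + k)) := by
    rw [map_sum, map_sum, LinearMap.sum_apply, Finset.smul_sum]
    refine Finset.sum_congr rfl fun k hk => ?_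
    have hk := Finset.mem_range.1 hk
    rw [show i + 2 + k = i + k + 2 by omega,
      jucysMurphy_comp_cup_of_ge hqr hδ (show i ≤ i + k by omega) (by omega)]
  have e1 : ∑ k ∈ Finset.range (N + 2), jucysMurphy δ q (N + 2) k =
      ∑ k ∈ Finset.range i, jucysMurphy δ q (N + 2) k + jucysMurphy δ q (N + 2) i +
        jucysMurphy δ q (N + 2) (i + 1) +
        ∑ k ∈ Finset.range (N - i), jucysMurphy δ q (N + 2) (i + 2 + k) := by
    rw [← Finset.sum_range_succ, ← Finset.sum_range_succ, ← Finset.sum_range_add]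
    congr 2
    omega
  have e2 : ∑ k ∈ Finset.range N, jucysMurphy δ q N k =
      ∑ k ∈ Finset.range i, jucysMurphy δ q N k +
        ∑ k ∈ Finset.range (N - i), jucysMurphy δ q N (i + k) := by
    rw [← Finset.sum_range_add]
    congr 2
    omega
  rw [e1, e2]
  simp only [map_add, LinearMap.add_apply]
  rw [h1, h2, h3, gen_comp_jucysMurphy_comp_cup hqr hδ]
  rw [smul_add r, smul_smul, smul_smul,
    show r * (q ^ 3 - q) = q ^ 2 - 1 by linear_combination (q ^ 2 - 1) * hqr,
    show r * δ = 1 + r ^ 2 by rw [hδ]; linear_combination hqr]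
  module

end JucysMurphy

/-! ### Morphisms through fewer points. -/

section LowSpan

variable {R : Type*} [CommRing R] (δ : R) {n k m : ℕ}

theorem Hom.induction {P : Hom δ n m → Prop} (zero : P 0) (add : ∀ f g, P f → P g → P (f + g))
    (smul : ∀ (a : R) x, P (a • Hom.of δ x)) (f : Hom δ n m) : P f := by
  refine Finsupp.induction_linear (motive := P) f zero (fun f g => add f g) fun x a => ?_
  have h : (Finsupp.single x a : Diagram n m →₀ R) = a • Finsupp.single x (1 : R) := by
    rw [Finsupp.smul_single, smul_eq_mul, mul_one]
  rw [h]
  exact smul a x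

/-- The span of the morphisms `n → m` that factor through some `i < m`. -/
noncomputable def lowSpan (n m : ℕ) : Submodule R (Hom δ n m) :=
  Submodule.span R {f | ∃ i < m, ∃ (g : Diagram n i) (h : Diagram i m),
    f = Hom.comp δ (Hom.of δ g) (Hom.of δ h)}

theorem comp_mem_lowSpan (hk : k < m) (g : Hom δ n k) (h : Hom δ k m) :
    Hom.comp δ g h ∈ lowSpan δ n m := by
  induction g using Hom.induction with
  | zero => rw [LinearMap.map_zero₂]; exact zero_mem _
  | add f g hf hg => rw [LinearMap.map_add₂]; exact add_mem hf hg
  | smul a x =>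
    rw [LinearMap.map_smul₂]
    refine Submodule.smul_mem _ _ ?_
    induction h using Hom.induction with
    | zero => rw [map_zero]; exact zero_mem _
    | add f g hf hg => rw [map_add]; exact add_mem hf hg
    | smul a y =>
      rw [map_smul]
      exact Submodule.smul_mem _ _ (Submodule.subset_span ⟨k, hk, x, y, rfl⟩)

theorem comp_lowSpan (f : Hom δ n k) {y : Hom δ k m} (hy : y ∈ lowSpan δ k m) :
    Hom.comp δ f y ∈ lowSpan δ n m := by
  induction hy using Submodule.span_induction with
  | mem y hy =>
    obtain ⟨i, hi, g, h, rfl⟩ := hy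
    rw [← Hom.comp_assoc]
    exact comp_mem_lowSpan δ hi _ _
  | zero => rw [map_zero]; exact zero_mem _
  | add y z _ _ h1 h2 => rw [map_add]; exact add_mem h1 h2
  | smul a y _ h => rw [map_smul]; exact Submodule.smul_mem _ _ h

theorem lowSpan_comp {y : Hom δ n m} (hy : y ∈ lowSpan δ n m) (f : Hom δ m m) :
    Hom.comp δ y f ∈ lowSpan δ n m := by
  induction hy using Submodule.span_induction with
  | mem y hy =>
    obtain ⟨i, hi, g, h, rfl⟩ := hy
    rw [Hom.comp_assoc]
    exact comp_mem_lowSpan δ hi _ _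
  | zero => rw [LinearMap.map_zero₂]; exact zero_mem _
  | add y z _ _ h1 h2 => rw [LinearMap.map_add₂]; exact add_mem h1 h2
  | smul a y _ h => rw [LinearMap.map_smul₂]; exact Submodule.smul_mem _ _ h

/-- This inclusion is all that is needed to carry congruences modulo the scalar span over to the
cell modules. -/
theorem lowSpan_le_lower {f : Hom δ n m} (hf : f ∈ lowSpan δ n m) : f ∈ lower δ n m := by
  have h : lowSpan δ n m ≤ (lower δ n m).restrictScalars R := by
    refine Submodule.span_le.2 ?_
    rintro _ ⟨i, hi, g, h, rfl⟩
    exact Submodule.subset_span ⟨i, hi, _, _, rfl⟩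
  exact h hf

theorem gen_mem_lowSpan (n i : ℕ) : gen δ n i ∈ lowSpan δ n n := by
  match n with
  | 0 => exact zero_mem _
  | 1 => exact zero_mem _
  | N + 2 =>
    by_cases hi : i ≤ N
    · rw [gen_eq δ hi]
      exact comp_mem_lowSpan δ (by omega) _ _
    · rw [gen, dif_neg hi]
      exact zero_mem _

/-- A diagram starts with an arc, or factors through fewer points, or is the identity. -/
theorem Hom.of_cases (x : Diagram n m) :
    (∃ (N i : ℕ) (hi : i ≤ N) (hn : n = N + 2) (y : Diagram N m),
      hn ▸ Hom.of δ x = Hom.comp δ (Hom.cup δ hi) (Hom.of δ y)) ∨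
    Hom.of δ x ∈ lowSpan δ n m ∨ ∃ e : n = m, e ▸ x = Diagram.id m := by
  rcases x.adjacent_or_id with ⟨i, hi, h⟩ | ⟨i, hi, h⟩ | h
  · obtain ⟨N, rfl⟩ : ∃ N, n = N + 2 := ⟨n - 2, by omega⟩
    obtain ⟨y, hy⟩ := Diagram.exists_eq_cup_comp (by omega) x h
    refine Or.inl ⟨N, i, by omega, rfl, y, ?_⟩
    rw [Hom.cup_comp_of, hy]
  · obtain ⟨N, rfl⟩ : ∃ N, m = N + 2 := ⟨m - 2, by omega⟩
    obtain ⟨y, hy⟩ := Diagram.exists_eq_cup_comp (by omega) x.flip h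
    refine Or.inr (Or.inl ?_)
    have e : Hom.of δ x = Hom.comp δ (Hom.flip δ (Hom.of δ y))
        (Hom.cap δ (show i ≤ N by omega)) := by
      rw [← Hom.flip_cup, ← Hom.flip_comp, Hom.cup_comp_of, hy, Hom.flip_of, Diagram.flip_flip]
    rw [e]
    exact comp_mem_lowSpan δ (by omega) _ _
  · exact Or.inr (Or.inr h)

theorem Hom.of_mem_lowSpan_of_ne_id (x : Diagram n n) (hx : x ≠ Diagram.id n) :
    Hom.of δ x ∈ lowSpan δ n n := by
  rcases Hom.of_cases δ x with ⟨N, i, hi, rfl, y, h⟩ | h | ⟨e, h⟩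
  · have h : Hom.of δ x = Hom.comp δ (Hom.cup δ hi) (Hom.of δ y) := h
    rw [h]
    exact comp_mem_lowSpan δ (by omega) _ _
  · exact h
  · exact absurd h hx

/-- Modulo morphisms through fewer points every endomorphism is a scalar, so a composite `m → n → m`
reduces to a value of the standard form. -/
theorem Hom.sub_coeff_mem_lowSpan (f : Hom δ n n) :
    f - Hom.coeff δ (Diagram.id n) f • Hom.of δ (Diagram.id n) ∈ lowSpan δ n n := by
  induction f using Hom.induction with
  | zero => simp
  | add f g hf hg =>
    rw [map_add, add_smul, add_sub_add_comm]
    exact add_mem hf hg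
  | smul a x =>
    rw [map_smul, smul_assoc, ← smul_sub]
    refine Submodule.smul_mem _ _ ?_
    by_cases h : x = Diagram.id n
    · rw [h, Hom.coeff_of_self, one_smul, sub_self]
      exact zero_mem _
    · rw [Hom.coeff_of_ne δ h, zero_smul, sub_zero]
      exact Hom.of_mem_lowSpan_of_ne_id δ x h

end LowSpan

/-! ### The encircling strand and its eigenvalues. -/

section Casimir

variable {R : Type*} [CommRing R] {δ q r : R}

/-- A crossing is congruent to `q` modulo morphisms through fewer points, and `2 * k` crossings
occur. -/
theorem jucysMurphy_sub_mem_lowSpan (n k : ℕ) :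
    jucysMurphy δ q n k - q ^ (2 * k) • Hom.of δ (Diagram.id n) ∈ lowSpan δ n n := by
  induction k with
  | zero => simp [jucysMurphy]
  | succ k ih =>
    have e : jucysMurphy δ q n (k + 1) - q ^ (2 * (k + 1)) • Hom.of δ (Diagram.id n) =
        q ^ 2 • (jucysMurphy δ q n k - q ^ (2 * k) • Hom.of δ (Diagram.id n)) -
        q • Hom.comp δ (jucysMurphy δ q n k) (gen δ n k) -
        Hom.comp δ (gen δ n k) (Hom.comp δ (jucysMurphy δ q n k) (braid δ q n k)) := by
      rw [jucysMurphy_succ, braid_comp δ q k, comp_braid]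
      module
    rw [e]
    refine sub_mem (sub_mem (Submodule.smul_mem _ _ ih) (Submodule.smul_mem _ _ ?_)) ?_
    · exact comp_lowSpan δ _ (gen_mem_lowSpan δ n k)
    · exact lowSpan_comp δ (gen_mem_lowSpan δ n k) _

/-- The element of `TL_n` given by a closed strand encircling all the others, written in terms of
the Jucys--Murphy elements. -/
noncomputable def casimir (δ q r : R) (n : ℕ) : Hom δ n n :=
  r ^ n • (δ • Hom.of δ (Diagram.id n) +
    (q ^ 3 - q) • ∑ k ∈ Finset.range n, jucysMurphy δ q n k)

/-- The normalisation by `r ^ n` absorbs the factor `q ^ 2` acquired by the sum, and the constants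
match because `q ^ 2 * δ = δ + (q ^ 3 - q) * (1 + r ^ 2)`. -/
theorem casimir_comp_cup (hqr : q * r = 1) (hδ : δ = q + r) {N i : ℕ} (hi : i ≤ N) :
    Hom.comp δ (casimir δ q r (N + 2)) (Hom.cup δ hi) =
      Hom.comp δ (Hom.cup δ hi) (casimir δ q r N) := by
  have h : ∀ f : Hom δ (N + 2) N, r ^ N • f = r ^ (N + 2) • q ^ 2 • f := by
    intro f
    rw [smul_smul]
    congr 1
    linear_combination -r ^ N * (q * r + 1) * hqr
  simp only [casimir, map_add, map_smul, LinearMap.smul_apply, LinearMap.add_apply, Hom.comp_id]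
  rw [Hom.id_comp, sum_jucysMurphy_comp_cup hqr hδ hi, h, smul_add (q ^ 2), smul_smul (q ^ 2) δ,
    show q ^ 2 * δ = δ + (q ^ 3 - q) * (1 + r ^ 2) by
      rw [hδ]; linear_combination (r - q * (q * r)) * hqr]
  module

theorem casimir_sub_mem_lowSpan (hqr : q * r = 1) (hδ : δ = q + r) (m : ℕ) :
    casimir δ q r m - (q ^ (m + 1) + r ^ (m + 1)) • Hom.of δ (Diagram.id m) ∈ lowSpan δ m m := by
  -- A geometric series with its denominator cleared, so that `q ^ 2 - 1` need not be invertible.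
  have hg : ∀ k : ℕ, (q ^ 3 - q) * ∑ j ∈ Finset.range k, q ^ (2 * j) = q * (q ^ (2 * k) - 1) := by
    intro k
    induction k with
    | zero => simp
    | succ k ih => rw [Finset.sum_range_succ, mul_add, ih]; ring
  have hp : (q * r) ^ m = 1 := by rw [hqr, one_pow]
  have e : casimir δ q r m - (q ^ (m + 1) + r ^ (m + 1)) • Hom.of δ (Diagram.id m) =
      (r ^ m * (q ^ 3 - q)) • ∑ k ∈ Finset.range m,
        (jucysMurphy δ q m k - q ^ (2 * k) • Hom.of δ (Diagram.id m)) := by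
    rw [Finset.sum_sub_distrib, ← Finset.sum_smul, smul_sub, smul_smul, mul_assoc, hg, casimir,
      show q ^ (m + 1) + r ^ (m + 1) = r ^ m * δ + r ^ m * (q * (q ^ (2 * m) - 1)) by
        rw [hδ]; linear_combination -q ^ (m + 1) * hp]
    module
  rw [e]
  exact Submodule.smul_mem _ _ (sum_mem fun k _ => jucysMurphy_sub_mem_lowSpan m k)

/-- Each initial arc is moved to the left of the encircling strand, which lowers `n` by two. The
only remaining diagrams are those through fewer than `m` points and the identity of `m`. -/
theorem casimir_comp_of_sub_mem_lowSpan (hqr : q * r = 1) (hδ : δ = q + r) {n m : ℕ}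
    (x : Diagram n m) : Hom.comp δ (casimir δ q r n) (Hom.of δ x) -
      (q ^ (m + 1) + r ^ (m + 1)) • Hom.of δ x ∈ lowSpan δ n m := by
  induction n using Nat.strong_induction_on with
  | _ n ih =>
    rcases Hom.of_cases δ x with ⟨N, i, hi, rfl, y, h⟩ | h | ⟨e, h⟩
    · have h : Hom.of δ x = Hom.comp δ (Hom.cup δ hi) (Hom.of δ y) := h
      rw [h, ← Hom.comp_assoc, casimir_comp_cup hqr hδ, Hom.comp_assoc, ← map_smul, ← map_sub]
      exact comp_lowSpan δ _ (ih N (by omega) y)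
    · exact sub_mem (comp_lowSpan δ _ h) (Submodule.smul_mem _ _ h)
    · subst e
      have h : x = Diagram.id n := h
      rw [h, Hom.comp_id]
      exact casimir_sub_mem_lowSpan hqr hδ n

end Casimir

/-! ### Descent of coefficients along a linear retraction. -/

section Descent

variable {R S : Type*} [CommRing R] [CommRing S] [Algebra R S] (π : S →ₗ[R] R) (δ : R) {n k m : ℕ}

/-- Apply a linear map to the coefficients of a morphism. -/
noncomputable def Hom.mapCoeff : Hom (algebraMap R S δ) n m →+ Hom δ n m :=
  Finsupp.mapRange.addMonoidHom (ι := Diagram n m) π.toAddMonoidHom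

theorem Hom.mapCoeff_smul_of (a : S) (x : Diagram n m) :
    Hom.mapCoeff π δ (a • Hom.of (algebraMap R S δ) x) = π a • Hom.of δ x := by
  have h1 : a • Hom.of (algebraMap R S δ) x = (Finsupp.single x a : Diagram n m →₀ S) := by
    unfold Hom.of
    erw [Finsupp.smul_single, smul_eq_mul, mul_one]
  have h2 : π a • Hom.of δ x = (Finsupp.single x (π a) : Diagram n m →₀ R) := by
    unfold Hom.of
    erw [Finsupp.smul_single, smul_eq_mul, mul_one]
  rw [h1, h2]
  exact Finsupp.mapRange_single (hf := map_zero π.toAddMonoidHom)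

/-- Closed loops contribute powers of `δ`, which lies in the base ring, and `π` is linear over that
ring. -/
theorem Hom.mapCoeff_smul_comp (a : S) (x : Diagram n k) (y : Diagram k m) :
    Hom.mapCoeff π δ (a • Hom.comp (algebraMap R S δ) (Hom.of _ x) (Hom.of _ y)) =
      π a • Hom.comp δ (Hom.of δ x) (Hom.of δ y) := by
  rw [Hom.comp_of, Hom.comp_of, smul_smul, Hom.mapCoeff_smul_of, ← map_pow, mul_comm,
    ← Algebra.smul_def, map_smul, smul_eq_mul, mul_comm, mul_smul]

/-- As `π` is not assumed multiplicative, the right factor has to be a single diagram. -/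
theorem Hom.mapCoeff_comp_of (f : Hom (algebraMap R S δ) n k) (x : Diagram k m) :
    Hom.mapCoeff π δ (Hom.comp (algebraMap R S δ) f (Hom.of _ x)) =
      Hom.comp δ (Hom.mapCoeff π δ f) (Hom.of δ x) := by
  induction f using Hom.induction with
  | zero => simp
  | add f g hf hg => rw [LinearMap.map_add₂, map_add, map_add, LinearMap.map_add₂, hf, hg]
  | smul a y =>
    rw [LinearMap.map_smul₂, Hom.mapCoeff_smul_comp, Hom.mapCoeff_smul_of, LinearMap.map_smul₂]

theorem Hom.mapCoeff_mem_lowSpan {f : Hom (algebraMap R S δ) n m}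
    (hf : f ∈ lowSpan (algebraMap R S δ) n m) : Hom.mapCoeff π δ f ∈ lowSpan δ n m := by
  -- The span is taken over `S`, over which `π` is not linear, so the induction must treat all
  -- multiples of `f` at once.
  have h : ∀ a : S, Hom.mapCoeff π δ (a • f) ∈ lowSpan δ n m := by
    induction hf using Submodule.span_induction with
    | mem y hy =>
      obtain ⟨i, hi, g, h, rfl⟩ := hy
      intro a
      rw [Hom.mapCoeff_smul_comp]
      exact Submodule.smul_mem _ _ (comp_mem_lowSpan δ hi _ _)
    | zero => intro a; rw [smul_zero, map_zero]; exact zero_mem _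
    | add y z _ _ h1 h2 => intro a; rw [smul_add, map_add]; exact add_mem (h1 a) (h2 a)
    | smul b y _ h => intro a; rw [smul_smul]; exact h _
  simpa using h 1

/-- Power sums of the two roots of `X ^ 2 - δ X + 1` satisfy a recursion with coefficients in `R`.
-/
theorem exists_algebraMap_eq_pow_add_pow {q r : S} (hqr : q * r = 1)
    (hδ : algebraMap R S δ = q + r) (k : ℕ) : ∃ c : R, algebraMap R S c = q ^ k + r ^ k := by
  induction k using Nat.strong_induction_on with
  | _ k ih =>
    match k with
    | 0 => exact ⟨2, by rw [map_ofNat]; norm_num⟩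
    | 1 => exact ⟨δ, by simp [hδ]⟩
    | k + 2 =>
      obtain ⟨a, ha⟩ := ih k (by omega)
      obtain ⟨b, hb⟩ := ih (k + 1) (by omega)
      refine ⟨δ * b - a, ?_⟩
      rw [map_sub, map_mul, ha, hb, hδ]
      linear_combination (q ^ k + r ^ k) * hqr

/-- An element of `TL_n` that acts on each cell module `S(n, m)` by the scalar
`q ^ (m + 1) + q ^ (-(m + 1))`. -/
theorem exists_scalar_on_cells {q r : S} (hqr : q * r = 1) (hδ : algebraMap R S δ = q + r)
    (hπ : π 1 = 1) (n : ℕ) : ∃ (C : Hom δ n n) (c : ℕ → R),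
      (∀ m, algebraMap R S (c m) = q ^ (m + 1) + r ^ (m + 1)) ∧
      ∀ m (f : Hom δ n m), Hom.comp δ C f - c m • f ∈ lowSpan δ n m := by
  choose c hc using fun m : ℕ => exists_algebraMap_eq_pow_add_pow δ hqr hδ (m + 1)
  refine ⟨Hom.mapCoeff π δ (casimir (algebraMap R S δ) q r n), c, hc, fun m f => ?_⟩
  induction f using Hom.induction with
  | zero => simp
  | add f g hf hg =>
    rw [map_add, smul_add, add_sub_add_comm]
    exact add_mem hf hg
  | smul a x =>
    rw [map_smul, smul_comm, ← smul_sub]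
    refine Submodule.smul_mem _ _ ?_
    have h := Hom.mapCoeff_mem_lowSpan π δ (casimir_comp_of_sub_mem_lowSpan hqr hδ x)
    have hcm : π (algebraMap R S (c m)) = c m := by
      rw [Algebra.algebraMap_eq_smul_one, map_smul, hπ, smul_eq_mul, mul_one]
    rwa [map_sub, Hom.mapCoeff_comp_of, ← hc, Hom.mapCoeff_smul_of, hcm] at h

end Descent

/-! ### General facts on composition factors. -/

section CompositionFactors

variable {A N M : Type*} [Ring A] [AddCommGroup N] [Module A N] [AddCommGroup M] [Module A M]

theorem IsCompositionFactor.nontrivial (h : IsCompositionFactor A N M) : Nontrivial N := by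
  obtain ⟨s, -, -, i, ⟨e⟩⟩ := h
  have hlt : s i.castSucc < s i.succ := JordanHolderLattice.lt_of_isMaximal (s.step i)
  have : Nontrivial (s i.succ ⧸ (s i.castSucc).submoduleOf (s i.succ)) := by
    rw [Submodule.Quotient.nontrivial_iff, Ne, Submodule.submoduleOf_eq_top]
    exact hlt.not_ge
  exact e.toEquiv.nontrivial

/-- The annihilator of a module also kills its subquotients. -/
theorem IsCompositionFactor.smul_eq_zero (h : IsCompositionFactor A N M) {a : A}
    (ha : ∀ x : M, a • x = 0) (y : N) : a • y = 0 := by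
  obtain ⟨s, -, -, i, ⟨e⟩⟩ := h
  apply e.injective
  rw [map_smul, map_zero]
  induction e y using Submodule.Quotient.induction_on with
  | _ z =>
    rw [← Submodule.Quotient.mk_smul]
    have : a • z = 0 := Subtype.ext (ha z)
    rw [this, Submodule.Quotient.mk_zero]

end CompositionFactors

/-! ### Constraints on the composition factors of cell modules. -/

section Cells

variable {K : Type*} [Field K] {δ : K} {n m m' : ℕ}

theorem cellHead_mk_eq_zero_of_smul {c : K} (hc : c ≠ 0)
    (h : ∀ f : Hom δ n m, (Submodule.Quotient.mk (Submodule.Quotient.mk (c • f) : CellModule δ n m) :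
      CellHead δ n m) = 0) (y : CellHead δ n m) : y = 0 := by
  induction y using Submodule.Quotient.induction_on with
  | _ s =>
    induction s using Submodule.Quotient.induction_on with
    | _ f =>
      have := h (c⁻¹ • f)
      rwa [smul_smul, mul_inv_cancel₀ hc, one_smul] at this

/-- As `D(n, m)` is nonzero, some value `⟨y, z⟩` is nonzero, and `x ι(y)` sends `z` to `⟨y, z⟩ x` in
`S(n, m)`. If `m < m'`, then `x ι(y)` kills `S(n, m')`, hence `D(n, m)`, so every `x` would vanish
there. -/
theorem IsCompositionFactor.cell_le
    (h : IsCompositionFactor (TL δ n) (CellHead δ n m) (CellModule δ n m')) : m' ≤ m := by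
  by_contra hlt
  push Not at hlt
  have := h.nontrivial
  obtain ⟨d, hd⟩ := exists_ne (0 : CellHead δ n m)
  induction d using Submodule.Quotient.induction_on with
  | _ s =>
  have hs : ¬ s ∈ cellRadical δ n m := fun hs => hd ((Submodule.Quotient.mk_eq_zero _).2 hs)
  have hs : ¬ ∀ t, cellForm δ n m t s = 0 := hs
  push Not at hs
  obtain ⟨t, ht⟩ := hs
  induction s using Submodule.Quotient.induction_on with
  | _ z =>
  induction t using Submodule.Quotient.induction_on with
  | _ y =>
  rw [cellForm_mk] at ht
  refine hd (cellHead_mk_eq_zero_of_smul ht (fun x => ?_) _)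
  let a : TL δ n := Hom.comp δ x (Hom.flip δ y)
  have ha : ∀ w : CellModule δ n m', a • w = 0 := by
    intro w
    induction w using Submodule.Quotient.induction_on with
    | _ f =>
    rw [← Submodule.Quotient.mk_smul, Submodule.Quotient.mk_eq_zero]
    change Hom.comp δ (Hom.comp δ x (Hom.flip δ y)) f ∈ lower δ n m'
    rw [Hom.comp_assoc]
    exact lowSpan_le_lower δ (comp_mem_lowSpan δ hlt _ _)
  have h0 := h.smul_eq_zero ha (Submodule.Quotient.mk (Submodule.Quotient.mk z))
  have h1 : a • z - homForm δ n m y z • x ∈ lower δ n m := by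
    have h2 := comp_lowSpan δ x (Hom.sub_coeff_mem_lowSpan δ (Hom.comp δ (Hom.flip δ y) z))
    rw [map_sub, map_smul, Hom.comp_id, ← Hom.comp_assoc] at h2
    exact lowSpan_le_lower δ h2
  rw [← Submodule.Quotient.mk_smul, ← Submodule.Quotient.mk_smul,
    (Submodule.Quotient.eq _).2 h1] at h0
  exact h0

/-- The element `C - c m'` kills `S(n, m')`, and it acts on `D(n, m)` as `c m - c m'`. -/
theorem IsCompositionFactor.cell_scalar_eq
    (h : IsCompositionFactor (TL δ n) (CellHead δ n m) (CellModule δ n m')) (C : Hom δ n n)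
    (c : ℕ → K) (hC : ∀ k (f : Hom δ n k), Hom.comp δ C f - c k • f ∈ lowSpan δ n k) :
    c m = c m' := by
  by_contra hne
  have := h.nontrivial
  obtain ⟨d, hd⟩ := exists_ne (0 : CellHead δ n m)
  refine hd (cellHead_mk_eq_zero_of_smul (sub_ne_zero.2 hne) (fun x => ?_) _)
  let a : TL δ n := (C - c m' • Hom.of δ (Diagram.id n) : Hom δ n n)
  have hax : ∀ {k : ℕ} (f : Hom δ n k), a • f = Hom.comp δ C f - c m' • f := by
    intro k f
    change Hom.comp δ (C - c m' • Hom.of δ (Diagram.id n)) f = _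
    rw [LinearMap.map_sub₂, LinearMap.map_smul₂, Hom.id_comp]
  have ha : ∀ w : CellModule δ n m', a • w = 0 := by
    intro w
    induction w using Submodule.Quotient.induction_on with
    | _ f =>
    rw [← Submodule.Quotient.mk_smul, Submodule.Quotient.mk_eq_zero, hax]
    exact lowSpan_le_lower δ (hC m' f)
  have h0 := h.smul_eq_zero ha (Submodule.Quotient.mk (Submodule.Quotient.mk x))
  have h1 : a • x - (c m - c m') • x ∈ lower δ n m := by
    rw [hax, sub_smul, sub_sub_sub_cancel_right]
    exact lowSpan_le_lower δ (hC m x)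
  rw [← Submodule.Quotient.mk_smul, ← Submodule.Quotient.mk_smul,
    (Submodule.Quotient.eq _).2 h1] at h0
  exact h0

theorem Diagram.even_add (x : Diagram n m) : Even (n + m) := by
  have h := x.pairing.even_card Finset.univ fun _ _ _ _ => Finset.mem_univ _
  simpa using h

theorem even_add_of_nontrivial [Nontrivial (CellModule δ n m)] : Even (n + m) := by
  by_contra hodd
  have : IsEmpty (Diagram n m) := ⟨fun x => hodd x.even_add⟩
  obtain ⟨d, hd⟩ := exists_ne (0 : CellModule δ n m)
  induction d using Submodule.Quotient.induction_on with
  | _ f =>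
  refine hd ?_
  have : f = 0 := Finsupp.ext fun x => isEmptyElim x
  rw [this, Submodule.Quotient.mk_zero]

theorem IsCompositionFactor.cell_even
    (h : IsCompositionFactor (TL δ n) (CellHead δ n m) (CellModule δ n m')) : Even (m + m') := by
  have h1 := h.nontrivial
  have : Nontrivial (CellModule δ n m) :=
    (Submodule.Quotient.mk_surjective (cellRadical δ n m)).nontrivial
  -- Otherwise the unit of `TL_n` would kill `S(n, m')` and with it the nonzero factor `D(n, m)`.
  have : Nontrivial (CellModule δ n m') := by
    by_contra hn
    rw [not_nontrivial_iff_subsingleton] at hn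
    obtain ⟨d, hd⟩ := exists_ne (0 : CellHead δ n m)
    refine hd ?_
    rw [← one_smul (TL δ n) d]
    exact h.smul_eq_zero (fun x => Subsingleton.elim _ _) d
  have e1 : Even (n + m) := even_add_of_nontrivial (δ := δ)
  have e2 : Even (n + m') := even_add_of_nontrivial (δ := δ)
  rw [Nat.even_iff] at *
  omega

end Cells

/-! ### Orbits of the reflection group. -/

section Orbits

variable {ℓ : ℕ} {x y : ℤ}

theorem pointReflection_mem {c : ℤ} (hc : (ℓ : ℤ) ∣ c + 1) :
    Equiv.pointReflection c ∈ reflectionGroup ℓ := Subgroup.subset_closure ⟨c, hc, rfl⟩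

/-- A single reflection suffices, about the midpoint `v - 1` of `x` and `y`. -/
theorem mem_orbit_of_add {v : ℤ} (hv : (ℓ : ℤ) ∣ v) (h : x + y + 2 = 2 * v) :
    x ∈ MulAction.orbit (reflectionGroup ℓ) y := by
  refine ⟨⟨Equiv.pointReflection (v - 1), pointReflection_mem (by simpa using hv)⟩, ?_⟩
  change Equiv.pointReflection (v - 1) y = x
  rw [Equiv.pointReflection_apply, vsub_eq_sub, vadd_eq_add]
  linarith

/-- Translation by `2 * u` is the reflection about `-1` followed by the reflection about `u - 1`. -/
theorem mem_orbit_of_sub {u : ℤ} (hu : (ℓ : ℤ) ∣ u) (h : x - y = 2 * u) :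
    x ∈ MulAction.orbit (reflectionGroup ℓ) y := by
  have h1 : -2 - y ∈ MulAction.orbit (reflectionGroup ℓ) y :=
    mem_orbit_of_add (dvd_zero _) (by ring)
  have h2 : x ∈ MulAction.orbit (reflectionGroup ℓ) (-2 - y) :=
    mem_orbit_of_add hu (by linarith)
  rwa [MulAction.orbit_eq_iff.2 h1] at h2

end Orbits

/-! ### Vanishing of quantum numbers and the order of `q ^ 2`. -/

section Quantum

variable {R S : Type*} [CommRing R] [CommRing S] [Algebra R S] {δ : R} {q r : S}

theorem algebraMap_quantum_mul (hqr : q * r = 1) (hδ : algebraMap R S δ = q + r) (k : ℕ) :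
    algebraMap R S (quantum δ k) * (q - r) = q ^ k - r ^ k := by
  induction k using Nat.strong_induction_on with
  | _ k ih =>
    match k with
    | 0 => simp [quantum_zero]
    | 1 => simp [quantum_one]
    | k + 2 =>
      have h := quantum_rec δ ((k + 1 : ℕ) : ℤ)
      rw [show ((k + 1 : ℕ) : ℤ) + 1 = ((k + 2 : ℕ) : ℤ) by push_cast; ring,
        show ((k + 1 : ℕ) : ℤ) - 1 = (k : ℤ) by push_cast; ring] at h
      have h := congrArg (algebraMap R S) h
      rw [map_mul, map_add, hδ] at h
      have h0 := ih k (by omega)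
      have h1 := ih (k + 1) (by omega)
      linear_combination -(q - r) * h - h0 + (q + r) * h1 + (q ^ k - r ^ k) * hqr

/-- Since `q ≠ r`, the formula `[j] (q - r) = q ^ j - r ^ j` shows that `[j] = 0` exactly when `(q ^
2) ^ j = 1`. So for positive `k` the number `ℓ` is the order of `q ^ 2`. -/
theorem ell_dvd {K L : Type*} [Field K] [Field L] [Algebra K L] {δ : K} {q r : L}
    (hqr : q * r = 1) (hδ : algebraMap K L δ = q + r) (hne : q ^ 2 ≠ 1) {k : ℕ}
    (hk : q ^ (2 * k) = 1) : ell δ ∣ k := by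
  have hsub : q - r ≠ 0 := by
    intro h
    exact hne (by linear_combination q * h + hqr)
  have key : ∀ j : ℕ, quantum δ j = 0 ↔ (q ^ 2) ^ j = 1 := by
    intro j
    have h := algebraMap_quantum_mul hqr hδ j
    have hj : (q * r) ^ j = 1 := by rw [hqr, one_pow]
    rw [← (algebraMap K L).injective.eq_iff, map_zero]
    constructor
    · intro h0
      rw [h0, zero_mul] at h
      linear_combination -q ^ j * h + hj
    · intro h0
      have hr : r ^ j ≠ 0 := pow_ne_zero _ (right_ne_zero_of_mul_eq_one hqr)
      have e : q ^ j - r ^ j = 0 := by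
        linear_combination r ^ j * h0 - q ^ j * hj
      rw [e] at h
      exact (mul_eq_zero.1 h).resolve_right hsub
  -- For `k = 0` no vanishing quantum number is available, and `ell δ` may be `0`, the value that
  -- encodes `ℓ = ∞`.
  rcases Nat.eq_zero_or_pos k with rfl | hpos
  · exact dvd_zero _
  have hk' : (q ^ 2) ^ k = 1 := by rw [← pow_mul, hk]
  have hmem : k ∈ {k : ℕ | 0 < k ∧ quantum δ k = 0} := ⟨hpos, (key k).2 hk'⟩
  obtain ⟨h1, h2⟩ : ell δ ∈ {k : ℕ | 0 < k ∧ quantum δ k = 0} := Nat.sInf_mem ⟨k, hmem⟩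
  have h3 : orderOf (q ^ 2) ∣ ell δ := orderOf_dvd_of_pow_eq_one ((key _).1 h2)
  have h4 : ell δ ≤ orderOf (q ^ 2) :=
    Nat.sInf_le ⟨Nat.pos_of_dvd_of_pos h3 h1, (key _).2 (pow_orderOf_eq_one _)⟩
  rw [le_antisymm h4 (Nat.le_of_dvd h1 h3)]
  exact orderOf_dvd_of_pow_eq_one hk'

end Quantum

end TemperleyLieb

/-! ### The linkage theorem. -/

theorem mainTheorem10 {K : Type*} [Field K] (δ : K) (hδ : δ ≠ 2) (hδ' : δ ≠ -2) (n m m' : ℕ)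
    (h : TemperleyLieb.IsCompositionFactor (TemperleyLieb.TL δ n)
      (TemperleyLieb.CellHead δ n m) (TemperleyLieb.CellModule δ n m')) :
    m' ≤ m ∧
      (m : ℤ) ∈ MulAction.orbit (TemperleyLieb.reflectionGroup (TemperleyLieb.ell δ)) (m' : ℤ) := by
  have hle := h.cell_le
  refine ⟨hle, ?_⟩
  let L := AlgebraicClosure K
  obtain ⟨q, hq⟩ : ∃ q : L, q * q - algebraMap K L δ * q + 1 = 0 := by
    obtain ⟨q, hq⟩ := IsAlgClosed.exists_root
      (Polynomial.X ^ 2 - Polynomial.C (algebraMap K L δ) * Polynomial.X + 1) (by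
        have : (Polynomial.X ^ 2 - Polynomial.C (algebraMap K L δ) * Polynomial.X + 1 :
          Polynomial L).degree = 2 := by compute_degree!
        rw [this]
        decide)
    refine ⟨q, ?_⟩
    simpa [Polynomial.IsRoot, sq] using hq
  have hqr : q * (algebraMap K L δ - q) = 1 := by linear_combination -hq
  set r := algebraMap K L δ - q with hr
  have hqδ : algebraMap K L δ = q + r := by rw [hr]; ring
  clear_value r
  -- The cases `q = 1` and `q = -1` are exactly `δ = 2` and `δ = -2`.
  have hne : q ^ 2 ≠ 1 := by
    intro h1
    have h2 : (q - 1) * (q + 1) = 0 := by linear_combination h1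
    rcases mul_eq_zero.1 h2 with h3 | h3
    · have h4 : q = 1 := by linear_combination h3
      rw [h4, one_mul] at hqr
      refine hδ ((algebraMap K L).injective ?_)
      rw [hqδ, h4, hqr, map_ofNat]
      norm_num
    · have h4 : q = -1 := by linear_combination h3
      have h5 : r = -1 := by rw [h4] at hqr; linear_combination -hqr
      refine hδ' ((algebraMap K L).injective ?_)
      rw [hqδ, h4, h5, map_neg, map_ofNat]
      norm_num
  -- A `K`-linear projection of `L` onto the line `K`.
  obtain ⟨π, hπ⟩ := (Algebra.linearMap K L).exists_leftInverse_of_injective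
    (LinearMap.ker_eq_bot.2 (algebraMap K L).injective)
  have hπ1 : π 1 = 1 := by
    have := LinearMap.congr_fun hπ 1
    simpa using this
  obtain ⟨C, c, hc, hC⟩ := TemperleyLieb.exists_scalar_on_cells π δ hqr hqδ hπ1 n
  have heq := congrArg (algebraMap K L) (h.cell_scalar_eq C c hC)
  rw [hc, hc] at heq
  obtain ⟨v, hv⟩ := h.cell_even
  obtain ⟨u, rfl⟩ : ∃ u, m = m' + 2 * u := ⟨v - m', by omega⟩
  have hp : (q * r) ^ (m' + 1) = 1 := by rw [hqr, one_pow]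
  have hp' : (q * r) ^ (m' + 2 * u + 1) = 1 := by rw [hqr, one_pow]
  -- Multiplying the equality of the two scalars by `q ^ (m + 1)`, with `m = m' + 2 * u`, makes
  -- their difference factor.
  have hprod : (q ^ (2 * u) - 1) * (q ^ (2 * (m' + u + 1)) - 1) = 0 := by
    linear_combination q ^ (m' + 2 * u + 1) * heq - hp' + q ^ (2 * u) * hp
  rcases mul_eq_zero.1 hprod with h1 | h1
  · have hd := TemperleyLieb.ell_dvd hqr hqδ hne (sub_eq_zero.1 h1)
    refine TemperleyLieb.mem_orbit_of_sub (Int.natCast_dvd_natCast.2 hd) ?_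
    push_cast
    ring
  · have hd := TemperleyLieb.ell_dvd hqr hqδ hne (sub_eq_zero.1 h1)
    refine TemperleyLieb.mem_orbit_of_add (Int.natCast_dvd_natCast.2 hd) ?_
    push_cast
    ring
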